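/- Let $\mathfrak g$ be a finite-dimensional real Lie algebra of dimension $n$. For $\alpha\in\mathfrak g^*$ put $d\alpha(X,Y)=-\alpha([X,Y])$, let $\mathcal O(\alpha)\subset\mathfrak g^*$ be its coadjoint orbit (under a connected Lie group with Lie algebra $\mathfrak g$), and let the Cartan class $\operatorname{cl}(\alpha)$ be the codimension in $\mathfrak g$ of $\{X:\alpha(X)=0,\ d\alpha(X,\cdot)=0\}$. Assume that $\mathfrak g$ is indecomposable (it is not the direct sum of two nonzero ideals), that every coadjoint orbit that is not a single point has dimension $2$, and that there is $\omega\in\mathfrak g^*$ with $\operatorname{cl}(\omega)=3$. Say that $\mathfrak g$ is of type $\mathfrak m\oplus I_{n-1}$ if, as a vector space, $\mathfrak g=\mathfrak m\oplus I_{n-1}$ with $I_{n-1}$ an abelian ideal of codimension $1$ and $\mathfrak m$ a $1$-dimensional Lie subalgebra. * If $n\ge 7$, then $\mathfrak g$ is of type $\mathfrak m\oplus I_{n-1}$. * If $n=4$, then $\mathfrak g$ is of type $\mathfrak m\oplus I_3$, or $\mathfrak g^*$ has a basis $\omega_1,\dots,\omega_4$ satisfying one of the systems $$d\omega_3=\omega_1\wedge\omega_2,\quad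 d\omega_1=\omega_1\wedge\omega_4,\quad d\omega_2=-\omega_2\wedge\omega_4,\quad d\omega_4=0,$$ $$d\omega_3=\omega_1\wedge\omega_2,\quad d\omega_1=\omega_2\wedge\omega_4,\quad d\omega_2=-\omega_1\wedge\omega_4,\quad d\omega_4=0.$$ * If $n=5$, then $\mathfrak g$ is of type $\mathfrak m\oplus I_4$, or $\mathfrak g^*$ has a basis $\omega_1,\dots,\omega_5$ with $$d\omega_3=\omega_1\wedge\omega_2,\quad d\omega_1=d\omega_2=0,\quad d\omega_4=\omega_1\wedge\omega_3,\quad d\omega_5=\omega_2\wedge\omega_3.$$ * If $n=6$, then $\mathfrak g$ is of type $\mathfrak m\oplus I_5$, or $\mathfrak g^*$ has a basis $\omega_1,\dots,\omega_6$ with $$d\omega_3=\omega_1\wedge\omega_2,\quad d\omega_1=d\omega_2=d\omega_4=0,\quad d\omega_5=\omega_2\wedge\omega_4,\quad d\omega_6=\omega_1\wedge\omega_4.$$ -/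

import Mathlib

noncomputable section

namespace LieCoadjoint

variable (g : Type*) [LieRing g] [LieAlgebra ℝ g]

/-- The exponential `∑ f ^ k / k!` of an endomorphism; the series is summed in the canonical
(module) topology of `End g`, which for finite-dimensional `g` is the usual topology of a
finite-dimensional real vector space. -/
def endExp {V : Type*} [AddCommGroup V] [Module ℝ V] (f : Module.End ℝ V) : Module.End ℝ V :=
  letI : TopologicalSpace (Module.End ℝ V) := moduleTopology ℝ (Module.End ℝ V)
  ∑' k : ℕ, ((k.factorial : ℝ)⁻¹) • f ^ k

/-- The adjoint group of `g`: the subgroup of `GL(g)` generated by the `exp (ad X)`. It is the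
image `Ad(G)` of every connected Lie group `G` with Lie algebra `g`. -/
def adjointGroup : Subgroup (g ≃ₗ[ℝ] g) :=
  Subgroup.closure {φ | ∃ X : g, (φ : g →ₗ[ℝ] g) = endExp (LieAlgebra.ad ℝ g X)}

variable {g}

/-- The coadjoint orbit of `α`: all the forms `Ad*(x) α = α ∘ Ad(x)⁻¹`. -/
def coadjointOrbit (α : Module.Dual ℝ g) : Set (Module.Dual ℝ g) :=
  {β | ∃ φ ∈ adjointGroup g, β = α ∘ₗ (φ.symm : g →ₗ[ℝ] g)}

/-- The tangent space at `α` to the coadjoint orbit of `α` (an immersed submanifold of `g*`):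
the velocities at `α` of the smooth curves of `g*` that stay in the orbit. Smoothness and
derivatives in the finite-dimensional space `g*` are taken coordinatewise. -/
def orbitTangentSpace (α : Module.Dual ℝ g) : Submodule ℝ (Module.Dual ℝ g) :=
  Submodule.span ℝ {v | ∃ γ : ℝ → Module.Dual ℝ g,
    (∀ Y : g, ContDiff ℝ ((⊤ : ℕ∞) : WithTop ℕ∞) (fun t => γ t Y)) ∧ (∀ t, γ t ∈ coadjointOrbit α) ∧ γ 0 = α ∧
    ∀ Y : g, HasDerivAt (fun t => γ t Y) (v Y) 0}

/-- The dimension of the coadjoint orbit of `α`. -/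
def orbitDim (α : Module.Dual ℝ g) : ℕ := Module.finrank ℝ (orbitTangentSpace α)

/-- The differential of the left invariant form `α`: `dα(X, Y) = -α [X, Y]`. -/
def extDeriv (α : Module.Dual ℝ g) : g →ₗ[ℝ] g →ₗ[ℝ] ℝ :=
  LinearMap.mk₂ ℝ (fun X Y => -α ⁅X, Y⁆)
    (fun _ _ _ => by simp [add_comm]) (fun _ _ _ => by simp)
    (fun _ _ _ => by simp [add_comm]) (fun _ _ _ => by simp)

/-- The exterior product of two linear forms. -/
def wedge (α β : Module.Dual ℝ g) : g →ₗ[ℝ] g →ₗ[ℝ] ℝ :=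
  LinearMap.mk₂ ℝ (fun X Y => α X * β Y - α Y * β X)
    (fun _ _ _ => by simp; ring) (fun _ _ _ => by simp; ring)
    (fun _ _ _ => by simp; ring) (fun _ _ _ => by simp; ring)

/-- The characteristic space of `α`: the `X` with `α(X) = 0` and `i(X) dα = 0`. -/
def characteristicSpace (α : Module.Dual ℝ g) : Submodule ℝ g :=
  LinearMap.ker α ⊓ LinearMap.ker (extDeriv α)

/-- The Cartan class of `α`: the codimension of its characteristic space. -/
def cartanClass (α : Module.Dual ℝ g) : ℕ := Module.finrank ℝ (g ⧸ characteristicSpace α)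

variable (g)

/-- `g` is not the direct sum of two nonzero ideals. -/
def IsIndecomposable : Prop :=
  ∀ I J : LieIdeal ℝ g, IsCompl I J → I = ⊥ ∨ J = ⊥

/-- `g = m ⊕ I` as a vector space, with `m` a one-dimensional subalgebra and `I` an abelian
ideal of codimension one. -/
def IsLineSumAbelianIdeal : Prop :=
  ∃ (m : LieSubalgebra ℝ g) (I : LieIdeal ℝ g),
    Module.finrank ℝ m = 1 ∧ IsLieAbelian I ∧ Module.finrank ℝ (g ⧸ I.toSubmodule) = 1 ∧
    IsCompl m.toSubmodule I.toSubmodule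

/-- `g` has a basis of linear forms `ω₁, …, ω₄` with `dω₃ = ω₁ ∧ ω₂`, `dω₁ = ω₁ ∧ ω₄`,
`dω₂ = -ω₂ ∧ ω₄`, `dω₄ = 0` (here and below `ω i` stands for `ω_{i+1}`). -/
def IsFourDimHyperbolic : Prop :=
  ∃ ω : Module.Basis (Fin 4) ℝ (Module.Dual ℝ g),
    extDeriv (ω 2) = wedge (ω 0) (ω 1) ∧ extDeriv (ω 0) = wedge (ω 0) (ω 3) ∧
    extDeriv (ω 1) = -wedge (ω 1) (ω 3) ∧ extDeriv (ω 3) = 0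

/-- `g` has a basis of linear forms with `dω₃ = ω₁ ∧ ω₂`, `dω₁ = ω₂ ∧ ω₄`,
`dω₂ = -ω₁ ∧ ω₄`, `dω₄ = 0`. -/
def IsFourDimElliptic : Prop :=
  ∃ ω : Module.Basis (Fin 4) ℝ (Module.Dual ℝ g),
    extDeriv (ω 2) = wedge (ω 0) (ω 1) ∧ extDeriv (ω 0) = wedge (ω 1) (ω 3) ∧
    extDeriv (ω 1) = -wedge (ω 0) (ω 3) ∧ extDeriv (ω 3) = 0

/-- `g` has a basis of linear forms with `dω₃ = ω₁ ∧ ω₂`, `dω₁ = dω₂ = 0`,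
`dω₄ = ω₁ ∧ ω₃`, `dω₅ = ω₂ ∧ ω₃`. -/
def IsFiveDimExceptional : Prop :=
  ∃ ω : Module.Basis (Fin 5) ℝ (Module.Dual ℝ g),
    extDeriv (ω 2) = wedge (ω 0) (ω 1) ∧ extDeriv (ω 0) = 0 ∧ extDeriv (ω 1) = 0 ∧
    extDeriv (ω 3) = wedge (ω 0) (ω 2) ∧ extDeriv (ω 4) = wedge (ω 1) (ω 2)

/-- `g` has a basis of linear forms with `dω₃ = ω₁ ∧ ω₂`, `dω₁ = dω₂ = dω₄ = 0`,
`dω₅ = ω₂ ∧ ω₄`, `dω₆ = ω₁ ∧ ω₄`. -/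
def IsSixDimExceptional : Prop :=
  ∃ ω : Module.Basis (Fin 6) ℝ (Module.Dual ℝ g),
    extDeriv (ω 2) = wedge (ω 0) (ω 1) ∧ extDeriv (ω 0) = 0 ∧ extDeriv (ω 1) = 0 ∧
    extDeriv (ω 3) = 0 ∧ extDeriv (ω 4) = wedge (ω 1) (ω 3) ∧
    extDeriv (ω 5) = wedge (ω 0) (ω 3)

end LieCoadjoint

end

/-! Curves `α ∘ exp (t ad X)` stay in the orbit of `α`, so orbit dimension at most 2 bounds the rank
of every `dα` by 2, i.e. `dα ∧ dα = 0` for all `α` (`pfaffian_eq_zero`). Read over all `α`, this is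
the Plücker-type identity [x,y][z,w] − [x,z][y,w] + [x,w][y,z] = 0 in the symmetric square of g;
apart from it only Jacobi and indecomposability are needed.

Either an abelian ideal of codimension one splits off with a complementary line, or some e₁, e₂, e₃
have independent brackets, a frame (`isLineSumAbelianIdeal_or_exists_frame`). For a frame, the
identity is a linear syzygy, which gives g = ⟨e₁, e₂, e₃⟩ ⊕ Z with Z the centre
(`IsFrame.exists_add_mem_center`), and [g,g] is the 3-dimensional span D of the brackets.
Indecomposability forces Z ≤ D (`IsFrame.center_le_bracketSpan`), so n = 3 + dim Z ≤ 6. For n = 6, Z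
= D and g is the free 2-step nilpotent algebra on three generators. For n = 5, Z is a plane in D and
Jacobi fixes the structure. For n = 4, the frame is chosen with [e₁,e₂] spanning Z; then (ad e₃)³ =
k ad e₃ with k ≠ 0, and the sign of k separates the two systems. -/

open Module

/-! ### Exponentials, coadjoint orbits and the rank of `dα` -/

namespace LieCoadjoint

/-- Linear maps between finite-dimensional module topologies are continuous. Continuity of `e`
carries the series over; continuity of `e.symm` makes the target Hausdorff, so that the sum is
unique. -/
theorem endExp_algEquiv {V A : Type*} [AddCommGroup V] [Module ℝ V] [NormedRing A]
    [NormedAlgebra ℝ A] [FiniteDimensional ℝ A] (e : A ≃ₐ[ℝ] End ℝ V) (x : A) :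
    endExp (e x) = e (NormedSpace.exp x) := by
  let _ : TopologicalSpace (End ℝ V) := moduleTopology ℝ (End ℝ V)
  have : IsModuleTopology ℝ (End ℝ V) := ⟨rfl⟩
  have : ContinuousAdd (End ℝ V) := IsModuleTopology.toContinuousAdd ℝ (End ℝ V)
  have : CompleteSpace A := FiniteDimensional.complete ℝ A
  have : IsModuleTopology ℝ A := isModuleTopologyOfFiniteDimensional
  have he : Continuous (e.toLinearMap : A →ₗ[ℝ] End ℝ V) :=
    IsModuleTopology.continuous_of_linearMap _
  have he' : Continuous (e.symm.toLinearMap : End ℝ V →ₗ[ℝ] A) :=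
    IsModuleTopology.continuous_of_linearMap _
  have : T2Space (End ℝ V) := T2Space.of_injective_continuous (f := e.symm) e.symm.injective he'
  have h := (NormedSpace.exp_series_hasSum_exp' (𝕂 := ℝ) x).map
    (e.toLinearMap : A →ₗ[ℝ] End ℝ V) he
  have h2 := h.tsum_eq
  simp only [Function.comp_def, AlgEquiv.toLinearMap_apply, map_smul, map_pow] at h2
  exact h2

theorem exists_endExp_curve_of_algEquiv {V A : Type*} [AddCommGroup V] [Module ℝ V]
    [NormedRing A] [NormedAlgebra ℝ A] [FiniteDimensional ℝ A] (e : A ≃ₐ[ℝ] End ℝ V)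
    (f : End ℝ V) :
    ∃ c : ℝ → End ℝ V, (∀ t, c t = endExp (t • f)) ∧ c 0 = 1 ∧ (∀ t, c t * c (-t) = 1) ∧
      ∀ φ : Dual ℝ (End ℝ V),
        ContDiff ℝ ((⊤ : ℕ∞) : WithTop ℕ∞) (fun t => φ (c t)) ∧
        HasDerivAt (fun t => φ (c t)) (φ f) 0 := by
  let _ : NormedAlgebra ℚ A := NormedAlgebra.restrictScalars ℚ ℝ A
  have : CompleteSpace A := FiniteDimensional.complete ℝ A
  obtain ⟨x, rfl⟩ := e.surjective f
  refine ⟨fun t => e (NormedSpace.exp (t • x)), fun t => ?_, ?_, fun t => ?_, fun φ => ?_⟩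
  · rw [← map_smul, endExp_algEquiv]
  · simp only [zero_smul, NormedSpace.exp_zero, map_one]
  · rw [← map_mul, ← NormedSpace.exp_add_of_commute, neg_smul, add_neg_cancel,
      NormedSpace.exp_zero, map_one]
    rw [neg_smul]
    exact (Commute.refl _).neg_right
  · let ψ : A →L[ℝ] ℝ := LinearMap.toContinuousLinearMap (φ ∘ₗ e.toLinearMap)
    constructor
    · have h1 : ContDiff ℝ ((⊤ : ℕ∞) : WithTop ℕ∞) (NormedSpace.exp : A → A) :=
        contDiff_iff_contDiffAt.2 fun x => (NormedSpace.exp_analytic (𝕂 := ℝ) x).contDiffAt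
      exact ψ.contDiff.comp (h1.comp (contDiff_id.smul contDiff_const))
    · have h1 := hasDerivAt_exp_smul_const (𝕂 := ℝ) x (0 : ℝ)
      rw [zero_smul, NormedSpace.exp_zero, one_mul] at h1
      exact ψ.hasFDerivAt.comp_hasDerivAt (0 : ℝ) h1

variable {g : Type*} [LieRing g] [LieAlgebra ℝ g] [FiniteDimensional ℝ g]

/-- Every `f ∈ End g` generates a smooth one-parameter group `t ↦ exp (t f)`. -/
theorem exists_endExp_curve (f : End ℝ g) :
    ∃ c : ℝ → End ℝ g, (∀ t, c t = endExp (t • f)) ∧ c 0 = 1 ∧ (∀ t, c t * c (-t) = 1) ∧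
      ∀ φ : Dual ℝ (End ℝ g),
        ContDiff ℝ ((⊤ : ℕ∞) : WithTop ℕ∞) (fun t => φ (c t)) ∧
        HasDerivAt (fun t => φ (c t)) (φ f) 0 := by
  let V := EuclideanSpace ℝ (Fin (finrank ℝ g))
  have hV : finrank ℝ V = finrank ℝ g := by simp [V]
  let e : (V →L[ℝ] V) ≃ₐ[ℝ] End ℝ g := (Module.End.toContinuousLinearMap V).symm.trans
    ((LinearEquiv.ofFinrankEq V g hV).conjAlgEquiv ℝ)
  have : FiniteDimensional ℝ (V →L[ℝ] V) := LinearEquiv.finiteDimensional e.symm.toLinearEquiv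
  exact exists_endExp_curve_of_algEquiv e f

theorem exists_curve_coadjointOrbit (α : Dual ℝ g) (X : g) :
    ∃ γ : ℝ → Dual ℝ g,
      (∀ Y : g, ContDiff ℝ ((⊤ : ℕ∞) : WithTop ℕ∞) (fun t => γ t Y)) ∧
      (∀ t, γ t ∈ coadjointOrbit α) ∧ γ 0 = α ∧
      ∀ Y : g, HasDerivAt (fun t => γ t Y) (-extDeriv α X Y) 0 := by
  obtain ⟨c, hc, h0, hinv, hφ⟩ := exists_endExp_curve (LieAlgebra.ad ℝ g X)
  refine ⟨fun t => α ∘ₗ c t, fun Y => ?_, fun t => ?_, ?_, fun Y => ?_⟩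
  · exact (hφ (α ∘ₗ LinearMap.applyₗ Y)).1
  -- The orbit consists of the `α ∘ φ⁻¹`, so the group element is `exp (-t ad X)`.
  · refine ⟨LinearEquiv.ofLinearMap (c (-t)) (c t) ?_ (hinv t),
      Subgroup.subset_closure ⟨-t • X, ?_⟩, ?_⟩
    · have := hinv (-t)
      rwa [neg_neg] at this
    · rw [map_smul, ← hc]
      rfl
    · rfl
  · change α ∘ₗ c 0 = α
    rw [h0]; rfl
  · have := (hφ (α ∘ₗ LinearMap.applyₗ Y)).2
    simpa [extDeriv] using this

theorem range_extDeriv_le_orbitTangentSpace (α : Dual ℝ g) :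
    LinearMap.range (extDeriv α) ≤ orbitTangentSpace α := by
  rintro _ ⟨X, rfl⟩
  obtain ⟨γ, h1, h2, h3, h4⟩ := exists_curve_coadjointOrbit α X
  rw [← Submodule.neg_mem_iff]
  exact Submodule.subset_span ⟨γ, h1, h2, h3, h4⟩

theorem extDeriv_eq_zero_of_coadjointOrbit_eq (α : Dual ℝ g) (h : coadjointOrbit α = {α}) :
    extDeriv α = 0 := by
  ext X Y
  obtain ⟨γ, -, h2, -, h4⟩ := exists_curve_coadjointOrbit α X
  have hγ : (fun t => γ t Y) = fun _ => α Y := by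
    funext t
    have := h2 t
    rw [h] at this
    rw [this]
  have h5 := h4 Y
  rw [hγ] at h5
  simpa using h5.unique (hasDerivAt_const _ _)

theorem finrank_range_extDeriv_le_two
    (horb : ∀ α : Dual ℝ g, coadjointOrbit α ≠ {α} → orbitDim α = 2) (α : Dual ℝ g) :
    finrank ℝ (LinearMap.range (extDeriv α)) ≤ 2 := by
  by_cases h : coadjointOrbit α = {α}
  · rw [extDeriv_eq_zero_of_coadjointOrbit_eq α h, LinearMap.range_zero]
    simp
  · exact (Submodule.finrank_mono (range_extDeriv_le_orbitTangentSpace α)).trans (horb α h).le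

/-- Rank at most 2 gives a linear relation between `dα(x,·)`, `dα(y,·)`, `dα(z,·)`. As `α ⁅x, y⁆ ≠
0`, the coefficient of the third is nonzero; evaluating the relation at x, y, w and eliminating
leaves the Pfaffian. -/
theorem pfaffian_aux {α : Dual ℝ g} (h : finrank ℝ (LinearMap.range (extDeriv α)) ≤ 2)
    {x y : g} (hxy : α ⁅x, y⁆ ≠ 0) (z w : g) :
    α ⁅x, y⁆ * α ⁅z, w⁆ - α ⁅x, z⁆ * α ⁅y, w⁆ + α ⁅x, w⁆ * α ⁅y, z⁆ = 0 := by
  have hyx : α ⁅y, x⁆ = -α ⁅x, y⁆ := by rw [← lie_skew, map_neg]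
  have hzx : α ⁅z, x⁆ = -α ⁅x, z⁆ := by rw [← lie_skew, map_neg]
  have hzy : α ⁅z, y⁆ = -α ⁅y, z⁆ := by rw [← lie_skew, map_neg]
  have hdep : ¬ LinearIndependent ℝ
      (fun i => (LinearMap.range (extDeriv α)).subtype
        ((extDeriv α).rangeRestrict ((![x, y, z] : Fin 3 → g) i))) := by
    intro hli
    have := (LinearIndependent.of_comp _ hli).fintype_card_le_finrank
    simp at this
    omega
  rw [Fintype.not_linearIndependent_iff] at hdep
  obtain ⟨c, hc, i, hi⟩ := hdep
  have key : ∀ u, c 0 * α ⁅x, u⁆ + c 1 * α ⁅y, u⁆ + c 2 * α ⁅z, u⁆ = 0 := fun u => by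
    have := congrArg (fun φ : Dual ℝ g => φ u) hc
    simp only [Fin.sum_univ_three] at this
    change c 0 * -α ⁅x, u⁆ + c 1 * -α ⁅y, u⁆ + c 2 * -α ⁅z, u⁆ = 0 at this
    linarith
  have kx := key x
  have ky := key y
  have kw := key w
  simp only [lie_self, map_zero, hyx, hzx, hzy] at kx ky
  have hc2 : c 2 ≠ 0 := by
    intro h2
    rw [h2] at kx ky
    have h1 : c 1 = 0 := by
      have : c 1 * α ⁅x, y⁆ = 0 := by linarith
      exact (mul_eq_zero.1 this).resolve_right hxy
    have h0 : c 0 = 0 := by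
      have : c 0 * α ⁅x, y⁆ = 0 := by linarith
      exact (mul_eq_zero.1 this).resolve_right hxy
    fin_cases i <;> simp_all
  have : c 2 * (α ⁅x, y⁆ * α ⁅z, w⁆ - α ⁅x, z⁆ * α ⁅y, w⁆ + α ⁅x, w⁆ * α ⁅y, z⁆) = 0 := by
    linear_combination α ⁅x, y⁆ * kw + α ⁅y, w⁆ * kx - α ⁅x, w⁆ * ky
  exact (mul_eq_zero.1 this).resolve_left hc2

theorem pfaffian_eq_zero {α : Dual ℝ g} (h : finrank ℝ (LinearMap.range (extDeriv α)) ≤ 2)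
    (x y z w : g) :
    α ⁅x, y⁆ * α ⁅z, w⁆ - α ⁅x, z⁆ * α ⁅y, w⁆ + α ⁅x, w⁆ * α ⁅y, z⁆ = 0 := by
  by_cases h1 : α ⁅x, y⁆ = 0
  · by_cases h2 : α ⁅x, z⁆ = 0
    · by_cases h3 : α ⁅x, w⁆ = 0
      · simp [h1, h2, h3]
      · have := pfaffian_aux h h3 y z
        rw [← lie_skew w y, ← lie_skew w z, map_neg, map_neg] at this
        linarith
    · have := pfaffian_aux h h2 y w
      rw [← lie_skew z y, map_neg] at this
      linarith
  · exact pfaffian_aux h h1 z w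

end LieCoadjoint

namespace LieCoadjoint

/-! ### Linear syzygies in the symmetric square -/

theorem exists_dual_apply_eq {ι V : Type*} [AddCommGroup V] [Module ℝ V] {v : ι → V}
    (hv : LinearIndependent ℝ v) (c : ι → ℝ) : ∃ f : Dual ℝ V, ∀ i, f (v i) = c i := by
  obtain ⟨f, hf⟩ := LinearMap.exists_extend ((Basis.span hv).constr ℝ c)
  refine ⟨f, fun i => ?_⟩
  have h1 := (Basis.span hv).constr_basis ℝ c i
  rw [← hf] at h1
  simpa [Basis.span_apply] using h1

theorem eq_of_forall_dual_eq {V : Type*} [AddCommGroup V] [Module ℝ V] {p q : V}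
    (h : ∀ μ : Dual ℝ V, μ p = μ q) : p = q := by
  rw [← sub_eq_zero, ← forall_dual_apply_eq_zero_iff ℝ]
  intro μ
  rw [map_sub, h, sub_self]

/-- If `A p = 0` in the symmetric square and `A ≠ 0`, then `p = 0`. -/
theorem eq_zero_of_forall_dual_mul {V : Type*} [AddCommGroup V] [Module ℝ V] {A p : V}
    (hA : A ≠ 0) (h : ∀ μ : Dual ℝ V, μ A * μ p = 0) : p = 0 := by
  obtain ⟨a, ha⟩ : ∃ a : Dual ℝ V, a A ≠ 0 := by
    by_contra! h0
    exact hA ((forall_dual_apply_eq_zero_iff ℝ A).1 h0)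
  have hap : a p = 0 := (mul_eq_zero.1 (h a)).resolve_left ha
  rw [← forall_dual_apply_eq_zero_iff ℝ]
  intro μ
  have h1 := h (a + μ)
  have h2 := h μ
  simp only [LinearMap.add_apply, hap] at h1
  have : a A * μ p = 0 := by linarith
  exact (mul_eq_zero.1 this).resolve_left ha

/-- If `A p = B q` in the symmetric square and `A, B` are independent, then `p = k B` and
`q = k A`. -/
theorem exists_eq_smul_of_forall_dual_mul {V : Type*} [AddCommGroup V] [Module ℝ V]
    {A B p q : V} (hAB : LinearIndependent ℝ ![A, B])
    (h : ∀ μ : Dual ℝ V, μ A * μ p - μ B * μ q = 0) : ∃ k : ℝ, p = k • B ∧ q = k • A := by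
  obtain ⟨a, ha⟩ := exists_dual_apply_eq hAB ![1, 0]
  obtain ⟨b, hb⟩ := exists_dual_apply_eq hAB ![0, 1]
  have aA : a A = 1 := by simpa using ha 0
  have aB : a B = 0 := by simpa using ha 1
  have bA : b A = 0 := by simpa using hb 0
  have bB : b B = 1 := by simpa using hb 1
  have haa := h a
  have hbb := h b
  have hab := h (a + b)
  simp only [LinearMap.add_apply, aA, aB, bA, bB] at haa hbb hab
  refine ⟨a q, eq_of_forall_dual_eq fun μ => ?_, eq_of_forall_dual_eq fun μ => ?_⟩
  -- Polarising the quadratic identity between μ and a, which is 1 on A and 0 on B, isolates `μ p`.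
  · have h1 := h (a + μ)
    have h2 := h μ
    simp only [LinearMap.add_apply, aA, aB, map_smul, smul_eq_mul] at h1 ⊢
    linear_combination h1 - h2 - haa * (1 + μ A)
  · have h1 := h (b + μ)
    have h2 := h μ
    simp only [LinearMap.add_apply, bA, bB, map_smul, smul_eq_mul] at h1 ⊢
    linear_combination -h1 + h2 + hbb * (1 + μ B) + μ A * (hab - haa - hbb)

/-- If `A p - B q + C r = 0` in the symmetric square and `A, B, C` are independent, then
`(p, q, r)` is a combination of the Koszul relations. -/
theorem exists_koszul_of_forall_dual_mul {V : Type*} [AddCommGroup V] [Module ℝ V]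
    {A B C p q r : V} (hABC : LinearIndependent ℝ ![A, B, C])
    (h : ∀ μ : Dual ℝ V, μ A * μ p - μ B * μ q + μ C * μ r = 0) :
    ∃ u v w : ℝ, p = u • B + v • C ∧ q = u • A + w • C ∧ r = -v • A + w • B := by
  obtain ⟨a, ha⟩ := exists_dual_apply_eq hABC ![1, 0, 0]
  obtain ⟨b, hb⟩ := exists_dual_apply_eq hABC ![0, 1, 0]
  obtain ⟨c, hc⟩ := exists_dual_apply_eq hABC ![0, 0, 1]
  have aA : a A = 1 := by simpa using ha 0
  have aB : a B = 0 := by simpa using ha 1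
  have aC : a C = 0 := by simpa using ha 2
  have bA : b A = 0 := by simpa using hb 0
  have bB : b B = 1 := by simpa using hb 1
  have bC : b C = 0 := by simpa using hb 2
  have cA : c A = 0 := by simpa using hc 0
  have cB : c B = 0 := by simpa using hc 1
  have cC : c C = 1 := by simpa using hc 2
  have haa := h a
  have hbb := h b
  have hcc := h c
  have hab := h (a + b)
  have hac := h (a + c)
  have hbc := h (b + c)
  simp only [LinearMap.add_apply, aA, aB, aC, bA, bB, bC, cA, cB, cC] at haa hbb hcc hab hac hbc
  refine ⟨a q, -a r, b r, eq_of_forall_dual_eq fun μ => ?_, eq_of_forall_dual_eq fun μ => ?_,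
    eq_of_forall_dual_eq fun μ => ?_⟩
  · have h1 := h (a + μ)
    have h2 := h μ
    simp only [LinearMap.add_apply, aA, aB, aC, map_add, map_smul, smul_eq_mul] at h1 ⊢
    linear_combination h1 - h2 - haa * (1 + μ A)
  · have h1 := h (b + μ)
    have h2 := h μ
    simp only [LinearMap.add_apply, bA, bB, bC, map_add, map_smul, smul_eq_mul] at h1 ⊢
    linear_combination -h1 + h2 + hbb * (1 + μ B) + μ A * (hab - haa - hbb)
  · have h1 := h (c + μ)
    have h2 := h μ
    simp only [LinearMap.add_apply, cA, cB, cC, map_add, map_smul, smul_eq_mul] at h1 ⊢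
    linear_combination h1 - h2 - hcc * (1 + μ C) - μ A * (hac - haa - hcc)
      - μ B * (hbc - hbb - hcc)

/-! ### The dichotomy: abelian hyperplane ideal or frame -/

variable {g : Type*} [LieRing g] [LieAlgebra ℝ g]

variable (g) in
/-- All the forms `dα` have rank at most two: `dα ∧ dα = 0`. -/
def HasDecomposableDifferentials : Prop :=
  ∀ (α : Dual ℝ g) (x y z w : g),
    α ⁅x, y⁆ * α ⁅z, w⁆ - α ⁅x, z⁆ * α ⁅y, w⁆ + α ⁅x, w⁆ * α ⁅y, z⁆ = 0

/-- Since g = ℝx + H with H abelian, every `ad y` restricted to H is a multiple of `ad x`; stability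
under x alone makes H an ideal. -/
theorem isLineSumAbelianIdeal_of_hyperplane (H : Submodule ℝ g) {x : g} (hx : x ∉ H)
    (hspan : ∀ y, ∃ k : ℝ, y + k • x ∈ H) (habel : ∀ y ∈ H, ∀ z ∈ H, ⁅y, z⁆ = 0)
    (hideal : ∀ y ∈ H, ⁅x, y⁆ ∈ H) : IsLineSumAbelianIdeal g := by
  have hx0 : x ≠ 0 := fun h => hx (h ▸ H.zero_mem)
  have hcompl : IsCompl (Submodule.span ℝ {x}) H := by
    constructor
    · rw [Submodule.disjoint_def]
      intro y hy hyH
      obtain ⟨k, rfl⟩ := Submodule.mem_span_singleton.1 hy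
      by_contra hk
      have hk0 : k ≠ 0 := fun h => hk (by rw [h, zero_smul])
      exact hx ((H.smul_mem_iff hk0).1 hyH)
    · rw [codisjoint_iff, eq_top_iff]
      intro y _
      obtain ⟨k, hk⟩ := hspan y
      refine Submodule.mem_sup.2 ⟨(-k) • x, Submodule.smul_mem _ _
        (Submodule.mem_span_singleton_self x), y + k • x, hk, by module⟩
  let m : LieSubalgebra ℝ g :=
    { Submodule.span ℝ {x} with
      lie_mem' := by
        intro y z hy hz
        obtain ⟨k, rfl⟩ := Submodule.mem_span_singleton.1 hy
        obtain ⟨l, rfl⟩ := Submodule.mem_span_singleton.1 hz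
        simp }
  let I : LieIdeal ℝ g :=
    { H with
      lie_mem := by
        intro y z hz
        obtain ⟨k, hk⟩ := hspan y
        have h1 : ⁅y, z⁆ = (-k) • ⁅x, z⁆ := by
          have := habel _ hk z hz
          rw [add_lie, smul_lie] at this
          rw [neg_smul]
          exact eq_neg_of_add_eq_zero_left this
        change ⁅y, z⁆ ∈ H
        rw [h1]
        exact H.smul_mem _ (hideal z hz) }
  refine ⟨m, I, finrank_span_singleton hx0, ⟨fun y z => ?_⟩, ?_, hcompl⟩
  · exact Subtype.ext (habel y y.2 z z.2)
  · change finrank ℝ (g ⧸ H) = 1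
    rw [(Submodule.quotientEquivOfIsCompl H _ hcompl.symm).finrank_eq]
    exact finrank_span_singleton hx0

/-- The centralizer of `u`, as a subspace. -/
def centralizerOf (u : g) : Submodule ℝ g := LinearMap.ker (LieAlgebra.ad ℝ g u : g →ₗ[ℝ] g)

theorem mem_centralizerOf {u y : g} : y ∈ centralizerOf u ↔ ⁅u, y⁆ = 0 := by
  simp [centralizerOf]

theorem isLineSumAbelianIdeal_of_abelian [Nontrivial g] (h : ∀ x y : g, ⁅x, y⁆ = 0) :
    IsLineSumAbelianIdeal g := by
  obtain ⟨x, hx⟩ := exists_ne (0 : g)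
  obtain ⟨f, hf⟩ : ∃ a : Dual ℝ g, a x ≠ 0 := by
    by_contra! h0
    exact hx ((forall_dual_apply_eq_zero_iff ℝ x).1 h0)
  refine isLineSumAbelianIdeal_of_hyperplane (LinearMap.ker f) (x := x) (by simpa using hf)
    (fun y => ⟨-(f y / f x), ?_⟩) (fun y _ z _ => h y z) (fun y _ => by simp [h])
  simp [hf]

/-- The ideal is the centralizer of u: a hyperplane because `ad u` has rank one, abelian because the
Pfaffian identity reduces to [u,w][y,z] = 0 there, and stable because it contains v. -/
theorem isLineSumAbelianIdeal_of_collinear (hP : HasDecomposableDifferentials g) {u w v : g}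
    (huw : ⁅u, w⁆ ≠ 0) (huv : ⁅u, v⁆ = 0) (hv : ∀ x y : g, ∃ k : ℝ, ⁅x, y⁆ = k • v) :
    IsLineSumAbelianIdeal g := by
  obtain ⟨c, hc⟩ := hv u w
  have hc0 : c ≠ 0 := fun h => huw (by rw [hc, h, zero_smul])
  refine isLineSumAbelianIdeal_of_hyperplane (centralizerOf u) (x := w)
    (fun h => huw (mem_centralizerOf.1 h)) (fun y => ?_) (fun y hy z hz => ?_) (fun y _ => ?_)
  · obtain ⟨k, hk⟩ := hv u y
    refine ⟨-(k / c), mem_centralizerOf.2 ?_⟩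
    rw [lie_add, lie_smul, hk, hc, smul_smul, ← add_smul]
    field_simp
    simp
  · rw [mem_centralizerOf] at hy hz
    refine eq_zero_of_forall_dual_mul huw fun μ => ?_
    have := hP μ u w y z
    simpa [hy, hz] using this
  · obtain ⟨k, hk⟩ := hv w y
    rw [mem_centralizerOf, hk, lie_smul, huv, smul_zero]

theorem isLineSumAbelianIdeal_of_rank_one (hP : HasDecomposableDifferentials g) {v : g}
    (hne : ∃ x y : g, ⁅x, y⁆ ≠ 0) (hv : ∀ x y : g, ∃ k : ℝ, ⁅x, y⁆ = k • v) :
    IsLineSumAbelianIdeal g := by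
  by_cases h : ∃ w : g, ⁅v, w⁆ ≠ 0
  · obtain ⟨w, hw⟩ := h
    exact isLineSumAbelianIdeal_of_collinear hP hw (lie_self v) hv
  · push Not at h
    obtain ⟨x, y, hxy⟩ := hne
    exact isLineSumAbelianIdeal_of_collinear hP hxy (by rw [← lie_skew, h, neg_zero]) hv

/-- Nonzero brackets sharing an argument are collinear, so [x,y] and [a,b] are linked through [a,y];
when that vanishes, [x+a,y] = [x,y] serves instead. -/
theorem collinear_of_forall_not_linearIndependent
    (h : ∀ x a b : g, ¬ LinearIndependent ℝ ![⁅x, a⁆, ⁅x, b⁆]) {x y : g} (hxy : ⁅x, y⁆ ≠ 0)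
    (a b : g) : ∃ k : ℝ, ⁅a, b⁆ = k • ⁅x, y⁆ := by
  have key : ∀ x y : g, ⁅x, y⁆ ≠ 0 → ∀ b, ∃ k : ℝ, ⁅x, b⁆ = k • ⁅x, y⁆ := fun x y hxy b => by
    have := h x y b
    rw [LinearIndependent.pair_iff' hxy] at this
    push Not at this
    obtain ⟨k, hk⟩ := this
    exact ⟨k, hk.symm⟩
  have hyx : ⁅y, x⁆ ≠ 0 := by rw [← lie_skew]; exact neg_ne_zero.2 hxy
  obtain ⟨k, hk⟩ := key y x hyx a
  have hk' : ⁅a, y⁆ = k • ⁅x, y⁆ := by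
    rw [← lie_skew, hk, ← lie_skew x y, smul_neg]
  by_cases hk0 : k = 0
  · have h1 : ⁅x + a, y⁆ = ⁅x, y⁆ := by rw [add_lie, hk', hk0, zero_smul, add_zero]
    obtain ⟨l, hl⟩ := key (x + a) y (by rwa [h1]) b
    obtain ⟨m, hm⟩ := key x y hxy b
    refine ⟨l - m, ?_⟩
    rw [h1, add_lie, hm] at hl
    rw [sub_smul, ← hl]
    abel
  · obtain ⟨l, hl⟩ := key a y (by rw [hk']; exact smul_ne_zero hk0 hxy) b
    exact ⟨l * k, by rw [hl, hk', smul_smul]⟩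

/-- With [a,b] = 0 the identity becomes [x,a][b,y] = [x,b][a,y], so [a,y] and [b,y] are the same
multiple k of [x,a] and [x,b]. Then y + kx commutes with a and b, and the common centralizer of a
and b is the required hyperplane. -/
theorem isLineSumAbelianIdeal_of_pair (hP : HasDecomposableDifferentials g) {x a b : g}
    (hli : LinearIndependent ℝ ![⁅x, a⁆, ⁅x, b⁆]) (hab : ⁅a, b⁆ = 0) :
    IsLineSumAbelianIdeal g := by
  have hA : ⁅x, a⁆ ≠ 0 := by simpa using hli.ne_zero 0
  have hpair := LinearIndependent.pair_iff.1 hli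
  have hax : ⁅a, x⁆ = -⁅x, a⁆ := (lie_skew _ _).symm
  have hbx : ⁅b, x⁆ = -⁅x, b⁆ := (lie_skew _ _).symm
  set H : Submodule ℝ g := centralizerOf a ⊓ centralizerOf b with hH
  have memH : ∀ y, y ∈ H ↔ ⁅a, y⁆ = 0 ∧ ⁅b, y⁆ = 0 := fun y => by
    rw [hH, Submodule.mem_inf, mem_centralizerOf, mem_centralizerOf]
  have hxH : x ∉ H := fun h => hA (by rw [← neg_eq_zero, ← hax]; exact ((memH x).1 h).1)
  have hspan : ∀ y, ∃ k : ℝ, y + k • x ∈ H := fun y => by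
    obtain ⟨k, h1, h2⟩ := exists_eq_smul_of_forall_dual_mul (p := ⁅b, y⁆) (q := ⁅a, y⁆) hli
      (fun μ => by
        have := hP μ x a b y
        rw [hab, map_zero, mul_zero, add_zero] at this
        exact this)
    refine ⟨k, (memH _).2 ⟨?_, ?_⟩⟩
    · rw [lie_add, lie_smul, h2, hax]; module
    · rw [lie_add, lie_smul, h1, hbx]; module
  have habel : ∀ y ∈ H, ∀ z ∈ H, ⁅y, z⁆ = 0 := fun y hy z hz => by
    rw [memH] at hy hz
    refine eq_zero_of_forall_dual_mul hA fun μ => ?_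
    have := hP μ x a y z
    simpa [hy.1, hz.1] using this
  have haH : a ∈ H := (memH a).2 ⟨lie_self a, by rw [← lie_skew, hab, neg_zero]⟩
  have hbH : b ∈ H := (memH b).2 ⟨hab, lie_self b⟩
  refine isLineSumAbelianIdeal_of_hyperplane H hxH hspan habel fun y hy => ?_
  obtain ⟨k, hk⟩ := hspan ⁅x, y⁆
  suffices k = 0 by rwa [this, zero_smul, add_zero] at hk
  -- Jacobi for x, y, c with [y,c] = 0. Taking c = a and c = b puts k[x,a] and k[x,b] on one line,
  -- so k = 0.
  have key : ∀ c ∈ H, ∃ l : ℝ, ⁅x, c⁆ + l • x ∈ H ∧ k • ⁅x, c⁆ = l • ⁅x, y⁆ := fun c hc => by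
    obtain ⟨l, hl⟩ := hspan ⁅x, c⁆
    refine ⟨l, hl, ?_⟩
    have h1 := habel _ hk c hc
    have h2 := habel y hy _ hl
    have h3 := leibniz_lie x y c
    rw [habel y hy c hc, lie_zero] at h3
    rw [add_lie, smul_lie] at h1
    rw [lie_add, lie_smul, ← lie_skew y x] at h2
    have h4 : k • ⁅x, c⁆ + l • -⁅x, y⁆ = (⁅⁅x, y⁆, c⁆ + k • ⁅x, c⁆) + (⁅y, ⁅x, c⁆⁆ + l • -⁅x, y⁆)
      - (⁅⁅x, y⁆, c⁆ + ⁅y, ⁅x, c⁆⁆) := by abel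
    rw [h1, h2, ← h3] at h4
    rw [← sub_eq_zero, sub_eq_add_neg, ← smul_neg, h4]
    simp
  obtain ⟨s, -, hs⟩ := key a haH
  obtain ⟨t, -, ht⟩ := key b hbH
  by_contra hk0
  have h5 : (t * k) • ⁅x, a⁆ + (-(s * k)) • ⁅x, b⁆ = 0 := by
    rw [mul_smul, neg_smul, mul_smul, hs, ht]; module
  obtain ⟨h6, h7⟩ := hpair _ _ h5
  have ht0 : t = 0 := (mul_eq_zero.1 h6).resolve_right hk0
  rw [ht0, zero_smul] at ht
  have hB : ⁅x, b⁆ ≠ 0 := by simpa using hli.ne_zero 1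
  exact (smul_ne_zero hk0 hB) ht

theorem isLineSumAbelianIdeal_or_exists_frame [Nontrivial g]
    (hP : HasDecomposableDifferentials g) :
    IsLineSumAbelianIdeal g ∨
      ∃ x a b : g, LinearIndependent ℝ ![⁅x, a⁆, ⁅x, b⁆, ⁅a, b⁆] := by
  by_cases h0 : ∀ x y : g, ⁅x, y⁆ = 0
  · exact Or.inl (isLineSumAbelianIdeal_of_abelian h0)
  push Not at h0
  by_cases h : ∀ x a b : g, ¬ LinearIndependent ℝ ![⁅x, a⁆, ⁅x, b⁆]
  · left
    obtain ⟨x, y, hxy⟩ := h0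
    exact isLineSumAbelianIdeal_of_rank_one hP ⟨x, y, hxy⟩
      (collinear_of_forall_not_linearIndependent h hxy)
  push Not at h
  obtain ⟨x, a, b, hli⟩ := h
  by_cases h3 : LinearIndependent ℝ ![⁅x, a⁆, ⁅x, b⁆, ⁅a, b⁆]
  · exact Or.inr ⟨x, a, b, h3⟩
  left
  have hmem : ⁅a, b⁆ ∈ Submodule.span ℝ {⁅x, a⁆, ⁅x, b⁆} := by
    by_contra hmem
    apply h3
    rw [Set.pair_comm] at hmem
    have := linearIndependent_finSnoc.2 ⟨hli, by simpa using hmem⟩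
    have h4 : ![⁅x, a⁆, ⁅x, b⁆, ⁅a, b⁆] = Fin.snoc ![⁅x, a⁆, ⁅x, b⁆] ⁅a, b⁆ := by
      ext i
      fin_cases i <;> rfl
    rw [h4]
    exact this
  -- Shifting a and b by multiples of x leaves [x,a], [x,b] unchanged and can cancel [a,b] = s[x,a]
  -- + t[x,b].
  obtain ⟨s, t, hst⟩ := Submodule.mem_span_pair.1 hmem
  have hxa : ⁅x, a - t • x⁆ = ⁅x, a⁆ := by simp
  have hxb : ⁅x, b + s • x⁆ = ⁅x, b⁆ := by simp
  refine isLineSumAbelianIdeal_of_pair hP (x := x) (a := a - t • x) (b := b + s • x) ?_ ?_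
  · rwa [hxa, hxb]
  · rw [sub_lie, lie_add, smul_lie, hxb, ← hst, lie_smul, ← lie_skew a x]
    module

/-! ### Frames, the centre and the bound n ≤ 6 -/

variable (g) in
/-- The center of `g`, as a subspace. -/
def centerSubspace : Submodule ℝ g := LinearMap.ker (LieAlgebra.ad ℝ g : g →ₗ[ℝ] End ℝ g)

theorem mem_centerSubspace {z : g} : z ∈ centerSubspace g ↔ ∀ y : g, ⁅z, y⁆ = 0 := by
  simp only [centerSubspace, LinearMap.mem_ker, LieHom.coe_toLinearMap, LinearMap.ext_iff,
    LieAlgebra.ad_apply, LinearMap.zero_apply]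

theorem lie_eq_zero_of_mem_center {z : g} (hz : z ∈ centerSubspace g) (y : g) : ⁅y, z⁆ = 0 := by
  rw [← lie_skew, mem_centerSubspace.1 hz, neg_zero]

/-- Three vectors whose brackets are linearly independent. -/
def IsFrame (e₁ e₂ e₃ : g) : Prop :=
  ∀ a b c : ℝ, a • ⁅e₁, e₂⁆ + b • ⁅e₁, e₃⁆ + c • ⁅e₂, e₃⁆ = 0 → a = 0 ∧ b = 0 ∧ c = 0

theorem isFrame_iff_linearIndependent {e₁ e₂ e₃ : g} :
    IsFrame e₁ e₂ e₃ ↔ LinearIndependent ℝ ![⁅e₁, e₂⁆, ⁅e₁, e₃⁆, ⁅e₂, e₃⁆] := by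
  rw [Fintype.linearIndependent_iff]
  constructor
  · intro h c hc i
    rw [Fin.sum_univ_three] at hc
    obtain ⟨h0, h1, h2⟩ := h _ _ _ hc
    fin_cases i <;> assumption
  · intro h a b c habc
    have h' := h ![a, b, c] (by rw [Fin.sum_univ_three]; exact habc)
    exact ⟨h' 0, h' 1, h' 2⟩

theorem finrank_span_triple {V : Type*} [AddCommGroup V] [Module ℝ V] {x y z : V}
    (h : LinearIndependent ℝ ![x, y, z]) : finrank ℝ (Submodule.span ℝ {x, y, z}) = 3 := by
  have h1 := finrank_span_eq_card h
  have h2 : Set.range ![x, y, z] = {x, y, z} := by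
    ext w
    simp only [Matrix.range_cons, Matrix.range_empty, Set.mem_union, Set.mem_singleton_iff,
      Set.mem_empty_iff_false, Set.mem_insert_iff, or_false]
  rw [h2, Fintype.card_fin] at h1
  exact h1

namespace IsFrame

variable {e₁ e₂ e₃ : g}

theorem swap₂₃ (h : IsFrame e₁ e₂ e₃) : IsFrame e₁ e₃ e₂ := by
  intro a b c habc
  obtain ⟨h1, h2, h3⟩ := h b a (-c) (by rw [← habc, ← lie_skew e₃ e₂]; module)
  exact ⟨h2, h1, neg_eq_zero.1 h3⟩

theorem swap₁₂ (h : IsFrame e₁ e₂ e₃) : IsFrame e₂ e₁ e₃ := by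
  intro a b c habc
  obtain ⟨h1, h2, h3⟩ := h (-a) c b (by rw [← habc, ← lie_skew e₂ e₁]; module)
  exact ⟨neg_eq_zero.1 h1, h3, h2⟩

theorem lie₁₂_ne_zero (h : IsFrame e₁ e₂ e₃) : ⁅e₁, e₂⁆ ≠ 0 := fun h0 =>
  one_ne_zero (h 1 0 0 (by rw [h0]; module)).1

theorem coeff_eq_zero (h : IsFrame e₁ e₂ e₃) {a b c : ℝ}
    (hz : a • e₁ + b • e₂ + c • e₃ ∈ centerSubspace g) : a = 0 ∧ b = 0 ∧ c = 0 := by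
  have h1 := lie_eq_zero_of_mem_center hz e₁
  have h2 := lie_eq_zero_of_mem_center hz e₂
  simp only [lie_add, lie_smul, lie_self, ← lie_skew e₂ e₁] at h1 h2
  obtain ⟨hb, hc, -⟩ := h b c 0 (by rw [← h1]; module)
  obtain ⟨ha, -, -⟩ := h (-a) 0 c (by rw [← h2]; module)
  exact ⟨neg_eq_zero.1 ha, hb, hc⟩

/-- The identity for e₁, e₂, e₃, y is a linear syzygy of three independent brackets, hence a Koszul
one; its three coefficients correct y so that it commutes with the frame. Two corrected vectors y',
w' satisfy [e₁,e₂][y',w'] = 0, so they commute, and y' is central. -/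
theorem exists_add_mem_center (hP : HasDecomposableDifferentials g) (h : IsFrame e₁ e₂ e₃)
    (y : g) : ∃ a b c : ℝ, y + (a • e₁ + b • e₂ + c • e₃) ∈ centerSubspace g := by
  have hK : ∀ y : g, ∃ a b c : ℝ, ⁅e₁, y + (a • e₁ + b • e₂ + c • e₃)⁆ = 0 ∧
      ⁅e₂, y + (a • e₁ + b • e₂ + c • e₃)⁆ = 0 ∧ ⁅e₃, y + (a • e₁ + b • e₂ + c • e₃)⁆ = 0 := by
    intro y
    obtain ⟨u, v, w, h1, h2, h3⟩ := exists_koszul_of_forall_dual_mul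
      (p := ⁅e₃, y⁆) (q := ⁅e₂, y⁆) (r := ⁅e₁, y⁆) (isFrame_iff_linearIndependent.1 h)
      (fun μ => by linarith [hP μ e₁ e₂ e₃ y])
    refine ⟨u, v, -w, ?_, ?_, ?_⟩
    · simp only [lie_add, lie_smul, lie_self, h3]
      module
    · simp only [lie_add, lie_smul, lie_self, h2, ← lie_skew e₂ e₁]
      module
    · simp only [lie_add, lie_smul, lie_self, h1, ← lie_skew e₃ e₁, ← lie_skew e₃ e₂]
      module
  obtain ⟨a, b, c, h1, h2, h3⟩ := hK y
  refine ⟨a, b, c, mem_centerSubspace.2 fun w => ?_⟩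
  obtain ⟨a', b', c', h1', h2', -⟩ := hK w
  set y' := y + (a • e₁ + b • e₂ + c • e₃)
  have h4 : ⁅y', w + (a' • e₁ + b' • e₂ + c' • e₃)⁆ = 0 := by
    refine eq_zero_of_forall_dual_mul h.lie₁₂_ne_zero fun μ => ?_
    have := hP μ e₁ e₂ y' (w + (a' • e₁ + b' • e₂ + c' • e₃))
    rw [h1, h2, h1', h2'] at this
    simpa using this
  simp only [lie_add, lie_smul] at h4
  rw [← lie_skew y' e₁, ← lie_skew y' e₂, ← lie_skew y' e₃, h1, h2, h3] at h4
  simpa using h4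

/-- The span of the three brackets. -/
def bracketSpan (e₁ e₂ e₃ : g) : Submodule ℝ g :=
  Submodule.span ℝ {⁅e₁, e₂⁆, ⁅e₁, e₃⁆, ⁅e₂, e₃⁆}

theorem mem_bracketSpan {x : g} : x ∈ bracketSpan e₁ e₂ e₃ ↔
    ∃ a b c : ℝ, a • ⁅e₁, e₂⁆ + b • ⁅e₁, e₃⁆ + c • ⁅e₂, e₃⁆ = x :=
  Submodule.mem_span_triple

theorem finrank_bracketSpan (h : IsFrame e₁ e₂ e₃) : finrank ℝ (bracketSpan e₁ e₂ e₃) = 3 :=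
  finrank_span_triple (isFrame_iff_linearIndependent.1 h)

theorem lie_mem_bracketSpan (hP : HasDecomposableDifferentials g) (h : IsFrame e₁ e₂ e₃)
    (y w : g) : ⁅y, w⁆ ∈ bracketSpan e₁ e₂ e₃ := by
  obtain ⟨a, b, c, hy⟩ := h.exists_add_mem_center hP y
  obtain ⟨a', b', c', hw⟩ := h.exists_add_mem_center hP w
  have h1 : ⁅y, w⁆ = ⁅a • e₁ + b • e₂ + c • e₃, a' • e₁ + b' • e₂ + c' • e₃⁆ := by
    have h2 := mem_centerSubspace.1 hy w
    have h3 := lie_eq_zero_of_mem_center hw (a • e₁ + b • e₂ + c • e₃)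
    rw [add_lie] at h2
    rw [lie_add] at h3
    rw [eq_neg_of_add_eq_zero_left h2, eq_neg_of_add_eq_zero_left h3, neg_neg]
  rw [h1, mem_bracketSpan]
  refine ⟨a * b' - b * a', a * c' - c * a', b * c' - c * b', ?_⟩
  simp only [lie_add, add_lie, lie_smul, smul_lie, lie_self, ← lie_skew e₂ e₁, ← lie_skew e₃ e₁,
    ← lie_skew e₃ e₂]
  module

theorem finrank_center (hP : HasDecomposableDifferentials g) [FiniteDimensional ℝ g]
    (h : IsFrame e₁ e₂ e₃) : finrank ℝ (centerSubspace g) + 3 = finrank ℝ g := by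
  have hli : LinearIndependent ℝ ![e₁, e₂, e₃] := by
    rw [Fintype.linearIndependent_iff]
    intro c hc i
    rw [Fin.sum_univ_three] at hc
    obtain ⟨h0, h1, h2⟩ := h.coeff_eq_zero (a := c 0) (b := c 1) (c := c 2) (by
      have h5 : c 0 • e₁ + c 1 • e₂ + c 2 • e₃ = 0 := hc
      rw [h5]; exact Submodule.zero_mem _)
    fin_cases i <;> assumption
  have hcompl : IsCompl (centerSubspace g) (Submodule.span ℝ {e₁, e₂, e₃}) := by
    constructor
    · rw [Submodule.disjoint_def]
      intro y hy hyE
      obtain ⟨a, b, c, rfl⟩ := Submodule.mem_span_triple.1 hyE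
      obtain ⟨rfl, rfl, rfl⟩ := h.coeff_eq_zero hy
      simp
    · rw [codisjoint_iff, eq_top_iff]
      intro y _
      obtain ⟨a, b, c, hy⟩ := h.exists_add_mem_center hP y
      exact Submodule.mem_sup.2 ⟨_, hy, (-a) • e₁ + (-b) • e₂ + (-c) • e₃,
        Submodule.mem_span_triple.2 ⟨_, _, _, rfl⟩, by module⟩
  rw [← finrank_span_triple hli]
  exact Submodule.finrank_add_eq_of_isCompl hcompl

/-- A central z outside D would split off: ℝz is an ideal, and so is any hyperplane containing D ⊇
[g,g], in particular one avoiding z. -/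
theorem center_le_bracketSpan (hP : HasDecomposableDifferentials g) (hind : IsIndecomposable g)
    (h : IsFrame e₁ e₂ e₃) : centerSubspace g ≤ bracketSpan e₁ e₂ e₃ := by
  intro z hz
  by_contra hzD
  obtain ⟨f, hfz, hf⟩ := Submodule.exists_le_ker_of_notMem hzD
  have hz0 : z ≠ 0 := fun h0 => hzD (h0 ▸ Submodule.zero_mem _)
  let I : LieIdeal ℝ g :=
    { Submodule.span ℝ {z} with
      lie_mem := by
        intro y x hx
        obtain ⟨k, rfl⟩ := Submodule.mem_span_singleton.1 hx
        rw [lie_smul, lie_eq_zero_of_mem_center hz, smul_zero]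
        exact Submodule.zero_mem _ }
  let J : LieIdeal ℝ g :=
    { LinearMap.ker f with
      lie_mem := fun {y x} _ => hf (h.lie_mem_bracketSpan hP y x) }
  have hI : z ∈ I := Submodule.mem_span_singleton_self z
  have hJ : ⁅e₁, e₂⁆ ∈ J := hf (h.lie_mem_bracketSpan hP e₁ e₂)
  have hIJ : IsCompl I.toSubmodule J.toSubmodule := by
    constructor
    · rw [Submodule.disjoint_def]
      intro x hx hxJ
      obtain ⟨k, rfl⟩ := Submodule.mem_span_singleton.1 hx
      have h1 : f (k • z) = 0 := hxJ
      rw [map_smul, smul_eq_mul] at h1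
      rw [(mul_eq_zero.1 h1).resolve_right hfz, zero_smul]
    · rw [codisjoint_iff, eq_top_iff]
      intro y _
      refine Submodule.mem_sup.2 ⟨(f y / f z) • z, Submodule.smul_mem _ _ hI,
        y - (f y / f z) • z, ?_, by module⟩
      change f (y - (f y / f z) • z) = 0
      simp [hfz]
  rcases hind I J (LieSubmodule.isCompl_toSubmodule.1 hIJ) with h1 | h1
  · rw [h1] at hI
    exact hz0 ((LieSubmodule.mem_bot z).1 hI)
  · rw [h1] at hJ
    exact h.lie₁₂_ne_zero ((LieSubmodule.mem_bot _).1 hJ)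

theorem finrank_le_six (hP : HasDecomposableDifferentials g) [FiniteDimensional ℝ g]
    (hind : IsIndecomposable g) (h : IsFrame e₁ e₂ e₃) : finrank ℝ g ≤ 6 := by
  have h1 := Submodule.finrank_mono (h.center_le_bracketSpan hP hind)
  have h2 := h.finrank_center hP
  rw [h.finrank_bracketSpan] at h1
  omega

end IsFrame

/-! ### From structure constants to differentials of the dual basis -/

theorem extDeriv_eq_of_basis {n : ℕ} (b : Basis (Fin n) ℝ g) {α : Dual ℝ g}
    {F : g →ₗ[ℝ] g →ₗ[ℝ] ℝ} (hF : ∀ x y, F x y = -F y x)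
    (h : ∀ i j, i < j → -α ⁅b i, b j⁆ = F (b i) (b j)) : extDeriv α = F := by
  refine LinearMap.ext_basis b b fun i j => ?_
  change -α ⁅b i, b j⁆ = F (b i) (b j)
  rcases lt_trichotomy i j with hij | rfl | hij
  · exact h i j hij
  · have := hF (b i) (b i)
    rw [lie_self, map_zero]
    linarith
  · rw [hF, ← h j i hij, ← lie_skew, map_neg]

theorem wedge_skew (α β : Dual ℝ g) (x y : g) : wedge α β x y = -wedge α β y x := by
  change α x * β y - α y * β x = -(α y * β x - α x * β y)
  ring

theorem wedge_apply (α β : Dual ℝ g) (x y : g) : wedge α β x y = α x * β y - α y * β x := rfl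

theorem isSixDimExceptional_of_basis (b : Basis (Fin 6) ℝ g)
    (h01 : ⁅b 0, b 1⁆ = -b 2) (h02 : ⁅b 0, b 2⁆ = 0) (h03 : ⁅b 0, b 3⁆ = -b 5)
    (h04 : ⁅b 0, b 4⁆ = 0) (h05 : ⁅b 0, b 5⁆ = 0) (h12 : ⁅b 1, b 2⁆ = 0)
    (h13 : ⁅b 1, b 3⁆ = -b 4) (h14 : ⁅b 1, b 4⁆ = 0) (h15 : ⁅b 1, b 5⁆ = 0)
    (h23 : ⁅b 2, b 3⁆ = 0) (h24 : ⁅b 2, b 4⁆ = 0) (h25 : ⁅b 2, b 5⁆ = 0)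
    (h34 : ⁅b 3, b 4⁆ = 0) (h35 : ⁅b 3, b 5⁆ = 0) (h45 : ⁅b 4, b 5⁆ = 0) :
    IsSixDimExceptional g := by
  have hw : ∀ i j x y, wedge (b.dualBasis i) (b.dualBasis j) x y =
      -wedge (b.dualBasis i) (b.dualBasis j) y x := fun i j => wedge_skew _ _
  refine ⟨b.dualBasis, ?_, ?_, ?_, ?_, ?_, ?_⟩ <;>
  · refine extDeriv_eq_of_basis b (by first | exact hw _ _ | simp) fun i j hij => ?_
    fin_cases i <;> fin_cases j <;> first
      | exact absurd hij (by decide)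
      | simp [*, wedge_apply]

theorem isFiveDimExceptional_of_basis (b : Basis (Fin 5) ℝ g)
    (h01 : ⁅b 0, b 1⁆ = -b 2) (h02 : ⁅b 0, b 2⁆ = -b 3) (h03 : ⁅b 0, b 3⁆ = 0)
    (h04 : ⁅b 0, b 4⁆ = 0) (h12 : ⁅b 1, b 2⁆ = -b 4)
    (h13 : ⁅b 1, b 3⁆ = 0) (h14 : ⁅b 1, b 4⁆ = 0)
    (h23 : ⁅b 2, b 3⁆ = 0) (h24 : ⁅b 2, b 4⁆ = 0) (h34 : ⁅b 3, b 4⁆ = 0) :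
    IsFiveDimExceptional g := by
  have hw : ∀ i j x y, wedge (b.dualBasis i) (b.dualBasis j) x y =
      -wedge (b.dualBasis i) (b.dualBasis j) y x := fun i j => wedge_skew _ _
  refine ⟨b.dualBasis, ?_, ?_, ?_, ?_, ?_⟩ <;>
  · refine extDeriv_eq_of_basis b (by first | exact hw _ _ | simp) fun i j hij => ?_
    fin_cases i <;> fin_cases j <;> first
      | exact absurd hij (by decide)
      | simp [*, wedge_apply]

theorem isFourDimHyperbolic_of_basis (b : Basis (Fin 4) ℝ g)
    (h01 : ⁅b 0, b 1⁆ = -b 2) (h02 : ⁅b 0, b 2⁆ = 0) (h03 : ⁅b 0, b 3⁆ = -b 0)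
    (h12 : ⁅b 1, b 2⁆ = 0) (h13 : ⁅b 1, b 3⁆ = b 1) (h23 : ⁅b 2, b 3⁆ = 0) :
    IsFourDimHyperbolic g := by
  have hw : ∀ i j x y, wedge (b.dualBasis i) (b.dualBasis j) x y =
      -wedge (b.dualBasis i) (b.dualBasis j) y x := fun i j => wedge_skew _ _
  refine ⟨b.dualBasis, ?_, ?_, ?_, ?_⟩ <;>
  · refine extDeriv_eq_of_basis b (by
      first | exact hw _ _ | exact fun x y => congrArg Neg.neg (hw _ _ x y) | simp) fun i j hij => ?_
    fin_cases i <;> fin_cases j <;> first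
      | exact absurd hij (by decide)
      | simp [*, wedge_apply]

theorem isFourDimElliptic_of_basis (b : Basis (Fin 4) ℝ g)
    (h01 : ⁅b 0, b 1⁆ = -b 2) (h02 : ⁅b 0, b 2⁆ = 0) (h03 : ⁅b 0, b 3⁆ = b 1)
    (h12 : ⁅b 1, b 2⁆ = 0) (h13 : ⁅b 1, b 3⁆ = -b 0) (h23 : ⁅b 2, b 3⁆ = 0) :
    IsFourDimElliptic g := by
  have hw : ∀ i j x y, wedge (b.dualBasis i) (b.dualBasis j) x y =
      -wedge (b.dualBasis i) (b.dualBasis j) y x := fun i j => wedge_skew _ _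
  refine ⟨b.dualBasis, ?_, ?_, ?_, ?_⟩ <;>
  · refine extDeriv_eq_of_basis b (by
      first | exact hw _ _ | exact fun x y => congrArg Neg.neg (hw _ _ x y) | simp) fun i j hij => ?_
    fin_cases i <;> fin_cases j <;> first
      | exact absurd hij (by decide)
      | simp [*, wedge_apply]

/-- The basis formed by a linearly independent family of full cardinality. -/
theorem exists_basis_of_linearIndependent [FiniteDimensional ℝ g] {n : ℕ} [NeZero n]
    (hn : finrank ℝ g = n) {v : Fin n → g} (hv : LinearIndependent ℝ v) :
    ∃ b : Basis (Fin n) ℝ g, ∀ i, b i = v i :=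
  ⟨basisOfLinearIndependentOfCardEqFinrank hv (by rw [Fintype.card_fin, hn]), fun i => by simp⟩

/-! ### Frames in dimensions six and five -/

variable {e₁ e₂ e₃ : g}

theorem IsFrame.isSixDimExceptional [FiniteDimensional ℝ g] (h : IsFrame e₁ e₂ e₃)
    (hn : finrank ℝ g = 6) (hA : ⁅e₁, e₂⁆ ∈ centerSubspace g) (hB : ⁅e₁, e₃⁆ ∈ centerSubspace g)
    (hC : ⁅e₂, e₃⁆ ∈ centerSubspace g) : IsSixDimExceptional g := by
  -- The minus signs absorb the sign in `dα(X, Y) = -α ⁅X, Y⁆`; the order follows the target system,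
  -- with e₃ dual to ω₄.
  have hli : LinearIndependent ℝ ![e₁, e₂, -⁅e₁, e₂⁆, e₃, -⁅e₂, e₃⁆, -⁅e₁, e₃⁆] := by
    rw [Fintype.linearIndependent_iff]
    intro c hc
    rw [Fin.sum_univ_six] at hc
    change c 0 • e₁ + c 1 • e₂ + c 2 • -⁅e₁, e₂⁆ + c 3 • e₃ + c 4 • -⁅e₂, e₃⁆
      + c 5 • -⁅e₁, e₃⁆ = 0 at hc
    obtain ⟨h0, h1, h3⟩ := h.coeff_eq_zero (a := c 0) (b := c 1) (c := c 3) (by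
      have h6 : c 0 • e₁ + c 1 • e₂ + c 3 • e₃ =
          c 2 • ⁅e₁, e₂⁆ + c 4 • ⁅e₂, e₃⁆ + c 5 • ⁅e₁, e₃⁆ := by
        rw [← sub_eq_zero, ← hc]; module
      rw [h6]
      exact add_mem (add_mem (Submodule.smul_mem _ _ hA) (Submodule.smul_mem _ _ hC))
        (Submodule.smul_mem _ _ hB))
    rw [h0, h1, h3] at hc
    obtain ⟨h2, h5, h4⟩ := h (c 2) (c 5) (c 4) (by rw [← neg_eq_zero, ← hc]; module)
    intro i
    fin_cases i <;> assumption
  obtain ⟨b, hb⟩ := exists_basis_of_linearIndependent hn hli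
  have b0 : b 0 = e₁ := hb 0
  have b1 : b 1 = e₂ := hb 1
  have b2 : b 2 = -⁅e₁, e₂⁆ := hb 2
  have b3 : b 3 = e₃ := hb 3
  have b4 : b 4 = -⁅e₂, e₃⁆ := hb 4
  have b5 : b 5 = -⁅e₁, e₃⁆ := hb 5
  have zA := lie_eq_zero_of_mem_center hA
  have zB := lie_eq_zero_of_mem_center hB
  have zC := lie_eq_zero_of_mem_center hC
  have zA' := mem_centerSubspace.1 hA
  apply isSixDimExceptional_of_basis b <;>
    simp only [b0, b1, b2, b3, b4, b5, lie_neg, neg_lie, zA, zB, zC, zA', neg_neg, neg_zero]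

/-- By Jacobi, [e₁,e₂] commutes with e₃, so modulo the centre it is a nonzero multiple −c e₃. It can
replace e₃ in the basis, and [eᵢ,[e₁,e₂]] = −c[eᵢ,e₃] for i = 1, 2 gives the last two basis vectors.
-/
theorem IsFrame.isFiveDimExceptional_of_mem_center [FiniteDimensional ℝ g]
    (hP : HasDecomposableDifferentials g) (h : IsFrame e₁ e₂ e₃)
    (hn : finrank ℝ g = 5) (hA : ⁅e₁, e₂⁆ ∉ centerSubspace g) (hB : ⁅e₁, e₃⁆ ∈ centerSubspace g)
    (hC : ⁅e₂, e₃⁆ ∈ centerSubspace g) : IsFiveDimExceptional g := by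
  obtain ⟨a, b, c, hz⟩ := h.exists_add_mem_center hP ⁅e₁, e₂⁆
  have zB := lie_eq_zero_of_mem_center hB
  have zC := lie_eq_zero_of_mem_center hC
  have hA3 : ⁅⁅e₁, e₂⁆, e₃⁆ = 0 := by
    have h1 := leibniz_lie e₁ e₂ e₃
    rw [zB, zC, add_zero] at h1
    exact h1.symm
  have hab := mem_centerSubspace.1 hz e₃
  simp only [add_lie, smul_lie, lie_self, hA3] at hab
  obtain ⟨-, rfl, rfl⟩ := h 0 a b (by rw [← hab]; module)
  have hz' : ⁅e₁, e₂⁆ + c • e₃ ∈ centerSubspace g := by simpa using hz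
  have hc : c ≠ 0 := by
    rintro rfl
    exact hA (by simpa using hz')
  have h1A : ⁅e₁, ⁅e₁, e₂⁆⁆ = (-c) • ⁅e₁, e₃⁆ := by
    have := lie_eq_zero_of_mem_center hz' e₁
    rw [lie_add, lie_smul] at this
    rw [eq_neg_of_add_eq_zero_left this, neg_smul]
  have h2A : ⁅e₂, ⁅e₁, e₂⁆⁆ = (-c) • ⁅e₂, e₃⁆ := by
    have := lie_eq_zero_of_mem_center hz' e₂
    rw [lie_add, lie_smul] at this
    rw [eq_neg_of_add_eq_zero_left this, neg_smul]
  have hli : LinearIndependent ℝ ![e₁, e₂, -⁅e₁, e₂⁆, (-c) • ⁅e₁, e₃⁆, (-c) • ⁅e₂, e₃⁆] := by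
    rw [Fintype.linearIndependent_iff]
    intro d hd
    rw [Fin.sum_univ_five] at hd
    change d 0 • e₁ + d 1 • e₂ + d 2 • -⁅e₁, e₂⁆ + d 3 • (-c) • ⁅e₁, e₃⁆
      + d 4 • (-c) • ⁅e₂, e₃⁆ = 0 at hd
    obtain ⟨h0, h1, h2⟩ := h.coeff_eq_zero (a := d 0) (b := d 1) (c := d 2 * c) (by
      have h6 : d 0 • e₁ + d 1 • e₂ + (d 2 * c) • e₃ =
          d 2 • (⁅e₁, e₂⁆ + c • e₃) + (d 3 * c) • ⁅e₁, e₃⁆ + (d 4 * c) • ⁅e₂, e₃⁆ := by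
        rw [← sub_eq_zero, ← hd]; module
      rw [h6]
      exact add_mem (add_mem (Submodule.smul_mem _ _ hz') (Submodule.smul_mem _ _ hB))
        (Submodule.smul_mem _ _ hC))
    have h2' : d 2 = 0 := (mul_eq_zero.1 h2).resolve_right hc
    rw [h0, h1, h2'] at hd
    obtain ⟨-, h3, h4⟩ := h 0 (d 3 * c) (d 4 * c) (by rw [← neg_eq_zero, ← hd]; module)
    have h3' : d 3 = 0 := (mul_eq_zero.1 h3).resolve_right hc
    have h4' : d 4 = 0 := (mul_eq_zero.1 h4).resolve_right hc
    intro i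
    fin_cases i <;> assumption
  obtain ⟨b, hb⟩ := exists_basis_of_linearIndependent hn hli
  have b0 : b 0 = e₁ := hb 0
  have b1 : b 1 = e₂ := hb 1
  have b2 : b 2 = -⁅e₁, e₂⁆ := hb 2
  have b3 : b 3 = (-c) • ⁅e₁, e₃⁆ := hb 3
  have b4 : b 4 = (-c) • ⁅e₂, e₃⁆ := hb 4
  apply isFiveDimExceptional_of_basis b <;>
    simp only [b0, b1, b2, b3, b4, lie_neg, lie_smul, zB, zC, h1A, h2A, neg_neg, smul_zero]

/-- Here dim Z = 2 and dim D = 3, so D = Z ⊕ ℝ[e₁,e₂]. Subtracting a combination of e₁ and e₂ from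
e₃ makes [e₁,e₃] and [e₂,e₃] central. -/
theorem IsFrame.isFiveDimExceptional_of_notMem [FiniteDimensional ℝ g]
    (hP : HasDecomposableDifferentials g) (hind : IsIndecomposable g) (h : IsFrame e₁ e₂ e₃)
    (hn : finrank ℝ g = 5) (hA : ⁅e₁, e₂⁆ ∉ centerSubspace g) : IsFiveDimExceptional g := by
  have hZ := h.finrank_center hP
  have hle : centerSubspace g ⊔ Submodule.span ℝ {⁅e₁, e₂⁆} ≤ bracketSpan e₁ e₂ e₃ :=
    sup_le (h.center_le_bracketSpan hP hind)
      ((Submodule.span_singleton_le_iff_mem _ _).2 (h.lie_mem_bracketSpan hP _ _))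
  have hlt : centerSubspace g < centerSubspace g ⊔ Submodule.span ℝ {⁅e₁, e₂⁆} := by
    refine lt_of_le_of_ne le_sup_left fun h0 => hA ?_
    rw [h0]
    exact Submodule.mem_sup_right (Submodule.mem_span_singleton_self _)
  have heq : centerSubspace g ⊔ Submodule.span ℝ {⁅e₁, e₂⁆} = bracketSpan e₁ e₂ e₃ := by
    refine Submodule.eq_of_le_of_finrank_le hle ?_
    have := Submodule.finrank_lt_finrank_of_lt hlt
    rw [h.finrank_bracketSpan]
    omega
  have key : ∀ x y : g, ∃ k : ℝ, ⁅x, y⁆ - k • ⁅e₁, e₂⁆ ∈ centerSubspace g := fun x y => by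
    have := h.lie_mem_bracketSpan hP x y
    rw [← heq] at this
    obtain ⟨z, hz, w, hw, hzw⟩ := Submodule.mem_sup.1 this
    obtain ⟨k, rfl⟩ := Submodule.mem_span_singleton.1 hw
    exact ⟨k, by rwa [← hzw, add_sub_cancel_right]⟩
  obtain ⟨b, hb⟩ := key e₁ e₃
  obtain ⟨c, hc⟩ := key e₂ e₃
  have h1 : ⁅e₁, e₃ - b • e₂ + c • e₁⁆ = ⁅e₁, e₃⁆ - b • ⁅e₁, e₂⁆ := by
    simp
  have h2 : ⁅e₂, e₃ - b • e₂ + c • e₁⁆ = ⁅e₂, e₃⁆ - c • ⁅e₁, e₂⁆ := by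
    simp only [lie_add, lie_sub, lie_smul, lie_self, ← lie_skew e₂ e₁]
    module
  refine IsFrame.isFiveDimExceptional_of_mem_center hP
    (e₁ := e₁) (e₂ := e₂) (e₃ := e₃ - b • e₂ + c • e₁) ?_ hn hA (by rwa [h1]) (by rwa [h2])
  intro p q r hpqr
  rw [h1, h2] at hpqr
  obtain ⟨hp, rfl, rfl⟩ := h (p - q * b - r * c) q r (by rw [← hpqr]; module)
  exact ⟨by simpa using hp, rfl, rfl⟩

theorem IsFrame.isFiveDimExceptional [FiniteDimensional ℝ g]
    (hP : HasDecomposableDifferentials g) (hind : IsIndecomposable g) (h : IsFrame e₁ e₂ e₃)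
    (hn : finrank ℝ g = 5) : IsFiveDimExceptional g := by
  by_cases hA : ⁅e₁, e₂⁆ ∈ centerSubspace g
  · by_cases hB : ⁅e₁, e₃⁆ ∈ centerSubspace g
    · by_cases hC : ⁅e₂, e₃⁆ ∈ centerSubspace g
      · exfalso
        have hZ := h.finrank_center hP
        have hle : bracketSpan e₁ e₂ e₃ ≤ centerSubspace g := by
          refine Submodule.span_le.2 ?_
          rintro x (rfl | rfl | rfl) <;> assumption
        have := Submodule.finrank_mono hle
        rw [h.finrank_bracketSpan] at this
        omega
      · exact h.swap₁₂.swap₂₃.isFiveDimExceptional_of_notMem hP hind hn hC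
    · exact h.swap₂₃.isFiveDimExceptional_of_notMem hP hind hn hB
  · exact h.isFiveDimExceptional_of_notMem hP hind hn hA

/-! ### Frames in dimension four -/

theorem IsFrame.exists_frame_lie_eq (h : IsFrame e₁ e₂ e₃) {p : ℝ} (hp : p ≠ 0) (q r : ℝ) :
    ∃ f₁ f₂ f₃ : g, IsFrame f₁ f₂ f₃ ∧
      ⁅f₁, f₂⁆ = p • ⁅e₁, e₂⁆ + q • ⁅e₁, e₃⁆ + r • ⁅e₂, e₃⁆ := by
  have h12 : ⁅e₁ - (r / p) • e₃, p • e₂ + q • e₃⁆ =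
      p • ⁅e₁, e₂⁆ + q • ⁅e₁, e₃⁆ + r • ⁅e₂, e₃⁆ := by
    have hr : r = r / p * p := by field_simp
    conv_rhs => rw [hr]
    simp only [lie_add, sub_lie, lie_smul, smul_lie, lie_self, ← lie_skew e₃ e₂]
    module
  refine ⟨e₁ - (r / p) • e₃, p • e₂ + q • e₃, e₃, ?_, h12⟩
  intro a b c habc
  rw [h12] at habc
  simp only [sub_lie, add_lie, smul_lie, lie_self] at habc
  obtain ⟨h1, h2, h3⟩ := h (a * p) (a * q + b) (a * r + c * p) (by rw [← habc]; module)
  have ha : a = 0 := (mul_eq_zero.1 h1).resolve_right hp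
  subst ha
  exact ⟨rfl, by simpa using h2, by simpa [hp] using h3⟩

/-- Every bivector in dimension three is decomposable. A permutation of the frame brings a nonzero
coefficient to the front. -/
theorem IsFrame.exists_frame_lie_eq_of_ne_zero (h : IsFrame e₁ e₂ e₃) {z : g} (hz0 : z ≠ 0)
    (hz : z ∈ bracketSpan e₁ e₂ e₃) : ∃ f₁ f₂ f₃ : g, IsFrame f₁ f₂ f₃ ∧ ⁅f₁, f₂⁆ = z := by
  obtain ⟨p, q, r, rfl⟩ := IsFrame.mem_bracketSpan.1 hz
  by_cases hp : p = 0
  · by_cases hq : q = 0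
    · have hr : r ≠ 0 := by
        rintro rfl
        exact hz0 (by rw [hp, hq]; module)
      obtain ⟨f₁, f₂, f₃, hf, h1⟩ := h.swap₁₂.swap₂₃.exists_frame_lie_eq hr (-p) (-q)
      refine ⟨f₁, f₂, f₃, hf, h1.trans ?_⟩
      rw [← lie_skew e₂ e₁, ← lie_skew e₃ e₁]
      module
    · obtain ⟨f₁, f₂, f₃, hf, h1⟩ := h.swap₂₃.exists_frame_lie_eq hq p (-r)
      refine ⟨f₁, f₂, f₃, hf, h1.trans ?_⟩
      rw [← lie_skew e₃ e₂]
      module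
  · exact h.exists_frame_lie_eq hp q r

theorem isFourDimHyperbolic_of_eigenvectors [FiniteDimensional ℝ g] (hn : finrank ℝ g = 4)
    {t u w : g} (hu : ⁅t, u⁆ = u) (hw : ⁅t, w⁆ = -w) (huw : ⁅u, w⁆ ≠ 0)
    (hz : ⁅u, w⁆ ∈ centerSubspace g) : IsFourDimHyperbolic g := by
  have z := lie_eq_zero_of_mem_center hz
  have z' := mem_centerSubspace.1 hz
  have hu' : ⁅u, t⁆ = -u := by rw [← lie_skew, hu]
  have hw' : ⁅w, t⁆ = w := by rw [← lie_skew, hw, neg_neg]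
  have hu0 : u ≠ 0 := by rintro rfl; simp at huw
  have hli : LinearIndependent ℝ ![u, w, -⁅u, w⁆, t] := by
    rw [Fintype.linearIndependent_iff]
    intro c hc
    rw [Fin.sum_univ_four] at hc
    change c 0 • u + c 1 • w + c 2 • -⁅u, w⁆ + c 3 • t = 0 at hc
    have h1 : c 0 • u - c 1 • w = 0 := by
      have := congrArg (fun x => ⁅t, x⁆) hc
      simp only [lie_add, lie_smul, lie_neg, z, hu, hw, lie_self, lie_zero] at this
      rw [← this]; module
    have h2 : c 1 = 0 := by
      have := congrArg (fun x => ⁅u, x⁆) h1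
      simpa [huw] using this
    have h3 : c 0 = 0 := by
      rw [h2] at h1
      simpa [hu0] using h1
    rw [h2, h3] at hc
    have h4 : c 3 = 0 := by
      have := congrArg (fun x => ⁅x, u⁆) hc
      simpa [-lie_skew, z', hu, hu0] using this
    have h5 : c 2 = 0 := by
      rw [h4] at hc
      simpa [-lie_skew, huw] using hc
    intro i
    fin_cases i <;> assumption
  obtain ⟨b, hb⟩ := exists_basis_of_linearIndependent hn hli
  have b0 : b 0 = u := hb 0
  have b1 : b 1 = w := hb 1
  have b2 : b 2 = -⁅u, w⁆ := hb 2
  have b3 : b 3 = t := hb 3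
  apply isFourDimHyperbolic_of_basis b <;>
    simp only [b0, b1, b2, b3, lie_neg, neg_lie, z, z', hu', hw', neg_neg, neg_zero]

theorem isFourDimElliptic_of_rotation [FiniteDimensional ℝ g] (hn : finrank ℝ g = 4)
    {t u w : g} (hu : ⁅t, u⁆ = -w) (hw : ⁅t, w⁆ = u) (huw : ⁅u, w⁆ ≠ 0)
    (hz : ⁅u, w⁆ ∈ centerSubspace g) : IsFourDimElliptic g := by
  have z := lie_eq_zero_of_mem_center hz
  have z' := mem_centerSubspace.1 hz
  have hu' : ⁅u, t⁆ = w := by rw [← lie_skew, hu, neg_neg]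
  have hw' : ⁅w, t⁆ = -u := by rw [← lie_skew, hw]
  have hw0 : w ≠ 0 := by rintro rfl; simp at huw
  have hli : LinearIndependent ℝ ![u, w, -⁅u, w⁆, t] := by
    rw [Fintype.linearIndependent_iff]
    intro c hc
    rw [Fin.sum_univ_four] at hc
    change c 0 • u + c 1 • w + c 2 • -⁅u, w⁆ + c 3 • t = 0 at hc
    have h1 : c 1 • u - c 0 • w = 0 := by
      have := congrArg (fun x => ⁅t, x⁆) hc
      simp only [lie_add, lie_smul, lie_neg, z, hu, hw, lie_self, lie_zero] at this
      rw [← this]; module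
    have h2 : c 0 = 0 := by
      have := congrArg (fun x => ⁅u, x⁆) h1
      simpa [huw] using this
    have h3 : c 1 = 0 := by
      have := congrArg (fun x => ⁅x, w⁆) h1
      simpa [huw] using this
    rw [h2, h3] at hc
    have h4 : c 3 = 0 := by
      have := congrArg (fun x => ⁅x, u⁆) hc
      simpa [-lie_skew, z', hu, hw0] using this
    have h5 : c 2 = 0 := by
      rw [h4] at hc
      simpa [-lie_skew, huw] using hc
    intro i
    fin_cases i <;> assumption
  obtain ⟨b, hb⟩ := exists_basis_of_linearIndependent hn hli
  have b0 : b 0 = u := hb 0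
  have b1 : b 1 = w := hb 1
  have b2 : b 2 = -⁅u, w⁆ := hb 2
  have b3 : b 3 = t := hb 3
  apply isFourDimElliptic_of_basis b <;>
    simp only [b0, b1, b2, b3, lie_neg, neg_lie, z, z', hu', hw', neg_neg, neg_zero]

/-- Rescale t to τ so that k becomes ±1, and put y = [τ,x], y' = [τ,y]. On ⟨y, y'⟩ the square of `ad
τ` is ±1: for +1, y ± y' are eigenvectors; for −1, `ad τ` is a rotation in y, −y'. -/
theorem isFourDim_of_ad_cube [FiniteDimensional ℝ g] (hn : finrank ℝ g = 4) {t x : g} {k : ℝ}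
    (hk : k ≠ 0) (hcube : ⁅t, ⁅t, ⁅t, x⁆⁆⁆ = k • ⁅t, x⁆) (hx : ⁅x, ⁅t, x⁆⁆ ≠ 0)
    (hz : ⁅x, ⁅t, x⁆⁆ ∈ centerSubspace g) : IsFourDimHyperbolic g ∨ IsFourDimElliptic g := by
  obtain ⟨s, hs0, hs⟩ : ∃ s : ℝ, s ≠ 0 ∧ (s * s * k = 1 ∨ s * s * k = -1) := by
    have h1 : 0 < |k| := abs_pos.2 hk
    have h2 : Real.sqrt |k| ≠ 0 := (Real.sqrt_pos.2 h1).ne'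
    refine ⟨(Real.sqrt |k|)⁻¹, inv_ne_zero h2, ?_⟩
    have h3 : (Real.sqrt |k|)⁻¹ * (Real.sqrt |k|)⁻¹ = |k|⁻¹ := by
      rw [← mul_inv, Real.mul_self_sqrt h1.le]
    rw [h3]
    rcases abs_choice k with h | h <;> rw [h]
    · left; field_simp
    · right; field_simp
  set τ := s • t with hτ
  have hcube' : ⁅τ, ⁅τ, ⁅τ, x⁆⁆⁆ = (s * s * k) • ⁅τ, x⁆ := by
    simp only [hτ, smul_lie, lie_smul, hcube]
    module
  have hx' : ⁅x, ⁅τ, x⁆⁆ ≠ 0 := by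
    rw [hτ, smul_lie, lie_smul]
    exact smul_ne_zero hs0 hx
  have hz' : ⁅x, ⁅τ, x⁆⁆ ∈ centerSubspace g := by
    rw [hτ, smul_lie, lie_smul]
    exact Submodule.smul_mem _ _ hz
  -- `ad τ` is a derivation killing the central vector [x,[τ,x]]; applied once more, it expresses
  -- [y,y'] through [x,y].
  have h1 : ⁅x, ⁅τ, ⁅τ, x⁆⁆⁆ = 0 := by
    have := leibniz_lie τ x ⁅τ, x⁆
    rwa [lie_eq_zero_of_mem_center hz', lie_self, zero_add, eq_comm] at this
  have h2 : ⁅⁅τ, x⁆, ⁅τ, ⁅τ, x⁆⁆⁆ = (-(s * s * k)) • ⁅x, ⁅τ, x⁆⁆ := by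
    have := leibniz_lie τ x ⁅τ, ⁅τ, x⁆⁆
    rw [h1, lie_zero, hcube', lie_smul] at this
    rw [eq_neg_of_add_eq_zero_left this.symm, neg_smul]
  generalize ⁅τ, x⁆ = y at *
  generalize hy' : ⁅τ, y⁆ = y' at *
  rcases hs with hs | hs
  · left
    rw [hs] at hcube' h2
    have huw : ⁅y + y', y - y'⁆ = (2 : ℝ) • ⁅x, y⁆ := by
      simp only [add_lie, lie_sub, lie_self, ← lie_skew y' y, h2]
      module
    refine isFourDimHyperbolic_of_eigenvectors hn (t := τ) (u := y + y') (w := y - y') ?_ ?_ ?_ ?_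
    · rw [lie_add, hy', hcube']; module
    · rw [lie_sub, hy', hcube']; module
    · rw [huw]; exact smul_ne_zero two_ne_zero hx'
    · rw [huw]; exact Submodule.smul_mem _ _ hz'
  · right
    rw [hs] at hcube' h2
    have huw : ⁅y, -y'⁆ = -⁅x, y⁆ := by
      rw [lie_neg, h2]
      module
    refine isFourDimElliptic_of_rotation hn (t := τ) (u := y) (w := -y') ?_ ?_ ?_ ?_
    · rw [hy', neg_neg]
    · rw [lie_neg, hcube']; module
    · rw [huw]; exact neg_ne_zero.2 hx'
    · rw [huw]; exact Submodule.neg_mem _ hz'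

/-- Jacobi makes `ad e₃` act on ⟨[e₁,e₃], [e₂,e₃]⟩ by a traceless 2 × 2 matrix, whose square is the
scalar b₁² + b₂c₁. This yields the cubic relation on e₁ and e₂; an x with [x,[e₃,x]] ≠ 0 remains to
be found. -/
theorem IsFrame.isFourDim_of_mem_center [FiniteDimensional ℝ g]
    (hP : HasDecomposableDifferentials g) (h : IsFrame e₁ e₂ e₃)
    (hn : finrank ℝ g = 4) (hA : ⁅e₁, e₂⁆ ∈ centerSubspace g) :
    IsFourDimHyperbolic g ∨ IsFourDimElliptic g := by
  have hZ := h.finrank_center hP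
  have hZA : ∀ z ∈ centerSubspace g, ∃ k : ℝ, k • ⁅e₁, e₂⁆ = z := fun z hz => by
    have h1 : finrank ℝ (centerSubspace g) = 1 := by omega
    obtain ⟨k, hk⟩ := (finrank_eq_one_iff_of_nonzero' (⟨⁅e₁, e₂⁆, hA⟩ : centerSubspace g)
      (fun h0 => h.lie₁₂_ne_zero (congrArg Subtype.val h0))).1 h1 ⟨z, hz⟩
    exact ⟨k, congrArg Subtype.val hk⟩
  obtain ⟨b₁, b₂, b₃, hb⟩ := h.exists_add_mem_center hP ⁅e₁, e₃⁆
  obtain ⟨c₁, c₂, c₃, hc⟩ := h.exists_add_mem_center hP ⁅e₂, e₃⁆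
  have h21 := lie_skew e₂ e₁
  have h31 := lie_skew e₃ e₁
  have h32 := lie_skew e₃ e₂
  have hJ : ⁅e₁, ⁅e₂, e₃⁆⁆ = ⁅e₂, ⁅e₁, e₃⁆⁆ := by
    have := leibniz_lie e₁ e₂ e₃
    rwa [mem_centerSubspace.1 hA, zero_add] at this
  have h1b := lie_eq_zero_of_mem_center hb e₁
  have h2b := lie_eq_zero_of_mem_center hb e₂
  have h1c := lie_eq_zero_of_mem_center hc e₁
  have h2c := lie_eq_zero_of_mem_center hc e₂
  simp only [lie_add, lie_smul, lie_self, ← h21] at h1b h2b h1c h2c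
  obtain ⟨hbc, rfl, hb3⟩ := h (b₁ + c₂) c₃ (-b₃) (by
    have h5 : (b₁ + c₂) • ⁅e₁, e₂⁆ + c₃ • ⁅e₁, e₃⁆ + (-b₃) • ⁅e₂, e₃⁆ =
      (⁅e₁, ⁅e₂, e₃⁆⁆ + (c₁ • (0 : g) + c₂ • ⁅e₁, e₂⁆ + c₃ • ⁅e₁, e₃⁆))
      - (⁅e₂, ⁅e₁, e₃⁆⁆ + (b₁ • -⁅e₁, e₂⁆ + b₂ • (0 : g) + b₃ • ⁅e₂, e₃⁆)) := by
      rw [hJ]; module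
    rw [h5, h1c, h2b, sub_zero])
  obtain rfl : b₃ = 0 := neg_eq_zero.1 hb3
  obtain rfl : c₂ = -b₁ := by linarith
  have h1B : ⁅e₁, ⁅e₁, e₃⁆⁆ = (-b₂) • ⁅e₁, e₂⁆ := by
    rw [← sub_eq_zero, ← h1b]; module
  have h2B : ⁅e₂, ⁅e₁, e₃⁆⁆ = b₁ • ⁅e₁, e₂⁆ := by
    rw [← sub_eq_zero, ← h2b]; module
  have h1C : ⁅e₁, ⁅e₂, e₃⁆⁆ = b₁ • ⁅e₁, e₂⁆ := by
    rw [← sub_eq_zero, ← h1c]; module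
  have h2C : ⁅e₂, ⁅e₂, e₃⁆⁆ = c₁ • ⁅e₁, e₂⁆ := by
    rw [← sub_eq_zero, ← h2c]; module
  have h3b := lie_eq_zero_of_mem_center hb e₃
  have h3c := lie_eq_zero_of_mem_center hc e₃
  simp only [lie_add, lie_smul, lie_self, ← h31, ← h32] at h3b h3c
  have h3B : ⁅e₃, ⁅e₁, e₃⁆⁆ = b₁ • ⁅e₁, e₃⁆ + b₂ • ⁅e₂, e₃⁆ := by
    rw [← sub_eq_zero, ← h3b]; module
  have h3C : ⁅e₃, ⁅e₂, e₃⁆⁆ = c₁ • ⁅e₁, e₃⁆ - b₁ • ⁅e₂, e₃⁆ := by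
    rw [← sub_eq_zero, ← h3c]; module
  -- If it vanished, b₁[e₁,e₃] + b₂[e₂,e₃] would be central, hence a multiple of [e₁,e₂].
  -- Independence gives b₁ = b₂ = 0, and then [e₁,e₃] itself is central, a contradiction.
  have hdet : b₁ * b₁ + b₂ * c₁ ≠ 0 := by
    intro h0
    have hBz : b₁ • ⁅e₁, e₃⁆ + b₂ • ⁅e₂, e₃⁆ ∈ centerSubspace g := by
      have h5 : b₁ • ⁅e₁, e₃⁆ + b₂ • ⁅e₂, e₃⁆ =
          b₁ • (⁅e₁, e₃⁆ + (b₁ • e₁ + b₂ • e₂ + (0 : ℝ) • e₃))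
          + b₂ • (⁅e₂, e₃⁆ + (c₁ • e₁ + -b₁ • e₂ + (0 : ℝ) • e₃)) - (b₁ * b₁ + b₂ * c₁) • e₁ := by
        module
      rw [h5, h0, zero_smul ℝ e₁, sub_zero]
      exact add_mem (Submodule.smul_mem _ _ hb) (Submodule.smul_mem _ _ hc)
    obtain ⟨k, hk⟩ := hZA _ hBz
    obtain ⟨-, rfl, rfl⟩ := h (-k) b₁ b₂ (by rw [neg_smul, hk]; abel)
    obtain ⟨l, hl⟩ := hZA _ hb
    obtain ⟨-, h6, -⟩ := h (-l) 1 0 (by rw [neg_smul, hl]; module)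
    exact one_ne_zero h6
  have h3e1 : ⁅e₃, ⁅e₃, ⁅e₃, e₁⁆⁆⁆ = (b₁ * b₁ + b₂ * c₁) • ⁅e₃, e₁⁆ := by
    rw [← h31, lie_neg, h3B, lie_neg, lie_add, lie_smul, lie_smul, h3B, h3C]
    module
  have h3e2 : ⁅e₃, ⁅e₃, ⁅e₃, e₂⁆⁆⁆ = (b₁ * b₁ + b₂ * c₁) • ⁅e₃, e₂⁆ := by
    rw [← h32, lie_neg, h3C, lie_neg, lie_sub, lie_smul, lie_smul, h3B, h3C]
    module
  have hx1 : ⁅e₁, ⁅e₃, e₁⁆⁆ = b₂ • ⁅e₁, e₂⁆ := by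
    rw [← h31, lie_neg, h1B]; module
  have hx2 : ⁅e₂, ⁅e₃, e₂⁆⁆ = (-c₁) • ⁅e₁, e₂⁆ := by
    rw [← h32, lie_neg, h2C]; module
  have hx3 : ⁅e₁ + e₂, ⁅e₃, e₁ + e₂⁆⁆ = (b₂ - c₁ - 2 * b₁) • ⁅e₁, e₂⁆ := by
    rw [lie_add e₃, ← h31, ← h32]
    simp only [add_lie, lie_add, lie_neg, h1B, h2B, h1C, h2C]
    module
  have conclude : ∀ (x : g) (m : ℝ), m ≠ 0 → ⁅x, ⁅e₃, x⁆⁆ = m • ⁅e₁, e₂⁆ →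
      ⁅e₃, ⁅e₃, ⁅e₃, x⁆⁆⁆ = (b₁ * b₁ + b₂ * c₁) • ⁅e₃, x⁆ →
      IsFourDimHyperbolic g ∨ IsFourDimElliptic g := fun x m hm hx hcube =>
    isFourDim_of_ad_cube hn hdet hcube (by rw [hx]; exact smul_ne_zero hm h.lie₁₂_ne_zero)
      (by rw [hx]; exact Submodule.smul_mem _ _ hA)
  -- [x,[e₃,x]] is a quadratic form in x ∈ ⟨e₁, e₂⟩ times [e₁,e₂], nonzero because b₁² + b₂c₁ ≠ 0,
  -- so it does not vanish at all of e₁, e₂, e₁ + e₂.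
  by_cases hb2 : b₂ = 0
  · by_cases hc1 : c₁ = 0
    · refine conclude (e₁ + e₂) _ (fun h0 => hdet ?_) hx3 ?_
      · have : b₁ = 0 := by linarith
        rw [this, hb2]; ring
      · simp only [lie_add, h3e1, h3e2, smul_add]
    · exact conclude e₂ _ (neg_ne_zero.2 hc1) hx2 h3e2
  · exact conclude e₁ _ hb2 hx1 h3e1

theorem IsFrame.isFourDim [FiniteDimensional ℝ g]
    (hP : HasDecomposableDifferentials g) (hind : IsIndecomposable g) (h : IsFrame e₁ e₂ e₃)
    (hn : finrank ℝ g = 4) : IsFourDimHyperbolic g ∨ IsFourDimElliptic g := by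
  have hZ := h.finrank_center hP
  have h1 : finrank ℝ (centerSubspace g) = 1 := by omega
  obtain ⟨z, hz0, -⟩ := finrank_eq_one_iff'.1 h1
  obtain ⟨f₁, f₂, f₃, hf, hfz⟩ := h.exists_frame_lie_eq_of_ne_zero
    (fun h0 => hz0 (Subtype.ext h0)) (h.center_le_bracketSpan hP hind z.2)
  exact hf.isFourDim_of_mem_center hP hn (by rw [hfz]; exact z.2)

end LieCoadjoint

theorem mainTheorem3 (g : Type*) [LieRing g] [LieAlgebra ℝ g] [FiniteDimensional ℝ g]
    (hind : LieCoadjoint.IsIndecomposable g)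
    (horb : ∀ α : Module.Dual ℝ g,
      LieCoadjoint.coadjointOrbit α ≠ {α} → LieCoadjoint.orbitDim α = 2)
    (hcl : ∃ ω : Module.Dual ℝ g, LieCoadjoint.cartanClass ω = 3) :
    (7 ≤ Module.finrank ℝ g → LieCoadjoint.IsLineSumAbelianIdeal g) ∧
    (Module.finrank ℝ g = 4 → LieCoadjoint.IsFourDimHyperbolic g ∨
      LieCoadjoint.IsFourDimElliptic g ∨ LieCoadjoint.IsLineSumAbelianIdeal g) ∧
    (Module.finrank ℝ g = 5 →
      LieCoadjoint.IsFiveDimExceptional g ∨ LieCoadjoint.IsLineSumAbelianIdeal g) ∧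
    (Module.finrank ℝ g = 6 →
      LieCoadjoint.IsSixDimExceptional g ∨ LieCoadjoint.IsLineSumAbelianIdeal g) := by
  have hP : LieCoadjoint.HasDecomposableDifferentials g := fun α =>
    LieCoadjoint.pfaffian_eq_zero (LieCoadjoint.finrank_range_extDeriv_le_two horb α)
  have : Nontrivial g := by
    obtain ⟨ω, hω⟩ := hcl
    by_contra hn
    rw [not_nontrivial_iff_subsingleton] at hn
    rw [LieCoadjoint.cartanClass, Module.finrank_zero_of_subsingleton] at hω
    omega
  rcases LieCoadjoint.isLineSumAbelianIdeal_or_exists_frame hP with h | ⟨e₁, e₂, e₃, he⟩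
  · exact ⟨fun _ => h, fun _ => Or.inr (Or.inr h), fun _ => Or.inr h, fun _ => Or.inr h⟩
  have hF := LieCoadjoint.isFrame_iff_linearIndependent.2 he
  refine ⟨fun hn => ?_, fun hn => ?_, fun hn => Or.inl ?_, fun hn => Or.inl ?_⟩
  · have := hF.finrank_le_six hP hind
    omega
  · rcases hF.isFourDim hP hind hn with h | h
    · exact Or.inl h
    · exact Or.inr (Or.inl h)
  · exact hF.isFiveDimExceptional hP hind hn
  · have hZ := hF.finrank_center hP
    have hle := hF.center_le_bracketSpan hP hind
    -- For n = 6 the centre has dimension 3, so Z = D and all brackets are central.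
    have heq := Submodule.eq_of_le_of_finrank_eq hle (by rw [hF.finrank_bracketSpan]; omega)
    have hmem : ∀ x y : g, ⁅x, y⁆ ∈ LieCoadjoint.centerSubspace g := fun x y => by
      rw [heq]
      exact hF.lie_mem_bracketSpan hP x y
    exact hF.isSixDimExceptional hn (hmem _ _) (hmem _ _) (hmem _ _)
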